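/- **Theorem 1.** Let $Y\in\{0,\dots,K-1\}$ be an unobserved categorical variable and $X$ a covariate with values in a measurable space; the law $p(y,x)$ of $(Y,X)$ is otherwise unrestricted. Let $P$ be a known nonsingular $K\times K$ matrix with nonnegative entries and columns summing to one. One observes $(Y^*,X)$, where $\Pr(Y^*=i-1\mid Y=j-1,X)=P_{ij}$. Let $\beta\in\mathbb{R}^d$ be defined by $E\{U(X,Y;\beta)\}=0$ for a known $U$ with values in $\mathbb{R}^d$ that is measurable in $x$, let $\mu_0$ be the true law of $(Y,X)$, $Q_0$ the induced law of $(Y^*,X)$, and $\beta_0$ a solution of the equation under $\mu_0$. Put $$\phi(y^*=i-1,x;\beta)=\mathbb{U}(x;\beta)P^{-1}e_i,\qquad \Omega=E_{\mu_0}\Big\{\frac{\partial U(X,Y;\beta)}{\partial\beta^{\mathsf T}}\Big\}\Big|_{\beta=\beta_0},$$ where $\mathbb{U}(x;\beta)$ is the $d\times K$ matrix with $k$-th column $U(x,k-1;\beta)$ and $e_i$ is the $i$-th basis vector of $\mathbb{R}^K$. Assume: * under $\mu_0$, $p(y^*\mid x)>0$ for all $y^*$ and almost all $x$; * $U$ is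 continuously differentiable in $\beta$ on a fixed neighbourhood of $\beta_0$ (the same for all $x,y$), and $\|\partial U/\partial\beta^{\mathsf T}\|$ has near $\beta_0$ a $\mu_0$-integrable envelope, i.e. a measurable function of $(y,x)$ that bounds it for all $\beta$ in some neighbourhood of $\beta_0$; * $\phi(\cdot;\beta_0)\in L^2(Q_0)$, and $\Omega$ is nonsingular. A *regular path* is a family of laws $(\mu_t)_{t\ge0}$ of $(Y,X)$ through the true law $\mu_0$ such that, with $Q_t$ the law of $(Y^*,X)$ induced by $\mu_t$, $E_{Q_t}\|\phi(Y^*,X;\beta_0)\|^2$ is bounded for small $t$, and for some $\mu_0$-integrable envelope $M$ as above $E_{\mu_t}M\to E_{\mu_0}M$ as $t\downarrow0$. Its score is a function $g\in L^2(Q_0)$ with $\int\{(\sqrt{dQ_t}-\sqrt{dQ_0})/t-\tfrac12 g\sqrt{dQ_0}\}^2\to0$ as $t\downarrow0$. Then: 1. Along every regular path that has a score there is a curve $t\mapsto\beta_t$, continuous at $0$ with value $\beta_0$ there, such that $E_{\mu_t}\{U(X,Y;\beta_t)\}=0$ for all small $t\ge0$; any two such curves agree for all small $t\ge 0$. 2.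 The efficient influence function for $\beta$ at $Q_0$ is $$\psi(y^*,x)=-\,\Omega^{-1}\phi(y^*,x;\beta_0).$$ That is, the coordinates of $\psi$ lie in the closed linear span, in $L^2(Q_0)$, of the scores of the regular paths, and along every regular path with score $g$ every curve $\beta_t$ as in 1 has right derivative $\int\psi g\,dQ_0$ at $t=0$. -/

import Mathlib

open MeasureTheory Filter Topology Set
open scoped ENNReal NNReal Matrix

noncomputable section

/- Part 1. Semiparametric theory: scores, tangent sets, efficient influence functions. -/

/-- The path of laws `t ↦ Q t`, `t ↓ 0`, is differentiable in quadratic mean at `Q₀` with score `g`: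
`∫ [ (√dQ_t - √dQ₀) / t - (1/2) g √dQ₀ ]² → 0` as `t ↓ 0`. The integral does not depend on the
dominating measure; here it is computed with `Q₀ + Q_t`. -/
def HasScore {Z : Type*} [MeasurableSpace Z] (Q₀ : Measure Z) (Q : ℝ → Measure Z)
    (g : Z → ℝ) : Prop :=
  Tendsto (fun t : ℝ => ∫⁻ z, ENNReal.ofReal
      (((√((Q t).rnDeriv (Q₀ + Q t) z).toReal - √(Q₀.rnDeriv (Q₀ + Q t) z).toReal) / t
        - (1 / 2) * g z * √(Q₀.rnDeriv (Q₀ + Q t) z).toReal) ^ 2) ∂(Q₀ + Q t))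
    (𝓝[>] 0) (𝓝 0)

/-- A family `S` of one-dimensional submodels through `Q₀` consists of pairs `(Q, b)`: a path of
laws `Q t` and the value `b t` of the parameter of interest at `Q t`. Its tangent set is the set of
all scores, as elements of `L²(Q₀)`. -/
def tangentSet {Z : Type*} [MeasurableSpace Z] {d : ℕ} (Q₀ : Measure Z)
    (S : Set ((ℝ → Measure Z) × (ℝ → EuclideanSpace ℝ (Fin d)))) : Set (Lp ℝ 2 Q₀) :=
  {g | ∃ s ∈ S, HasScore Q₀ s.1 g}

/-- `ψ` is the efficient influence function at `Q₀` of the parameter, relative to the submodels `S`: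
its coordinates belong to the closed linear span of the tangent set in `L²(Q₀)`, and along every
submodel with score `g` the parameter has the (right) derivative `∫ ψ g dQ₀` at `t = 0`. -/
def IsEfficientInfluenceFunction {Z : Type*} [MeasurableSpace Z] {d : ℕ} (Q₀ : Measure Z)
    (S : Set ((ℝ → Measure Z) × (ℝ → EuclideanSpace ℝ (Fin d))))
    (ψ : Z → EuclideanSpace ℝ (Fin d)) : Prop :=
  (∀ a : Fin d, ∃ h : MemLp (fun z => ψ z a) 2 Q₀,
      h.toLp (fun z => ψ z a) ∈ (Submodule.span ℝ (tangentSet Q₀ S)).topologicalClosure) ∧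
  ∀ s ∈ S, ∀ g : Lp ℝ 2 Q₀, HasScore Q₀ s.1 g →
    HasDerivWithinAt s.2 (WithLp.toLp 2 fun a : Fin d => ∫ z, ψ z a * g z ∂Q₀) (Ici 0) 0

/- Part 2. The PRAM model. The categories `0, …, K-1` are the elements of `Fin K`. A law of the
unobserved `(Y, X)` or of the observed `(Y*, X)` is a measure on `Fin K × 𝒳`. -/

/-- `P i j = Pr(Y* = i | Y = j)`: every column of `P` is a probability vector. -/
def IsTransitionMatrix {K : ℕ} (P : Matrix (Fin K) (Fin K) ℝ) : Prop :=
  (∀ i j, 0 ≤ P i j) ∧ ∀ j, ∑ i, P i j = 1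

/-- The law of `(Y*, X)` when `(Y, X)` has law `μ` and, given `(Y, X)`, the value `Y* = i` is drawn
with probability `P i Y`: `Pr(Y* = i, X ∈ B) = ∑ j, P i j * μ (Y = j, X ∈ B)`. -/
def obsLaw {K : ℕ} {𝒳 : Type*} [MeasurableSpace 𝒳] (P : Matrix (Fin K) (Fin K) ℝ)
    (μ : Measure (Fin K × 𝒳)) : Measure (Fin K × 𝒳) :=
  ∑ i : Fin K, ∑ j : Fin K, ENNReal.ofReal (P i j) •
    (μ.restrict {z | z.1 = j}).map (fun z => (i, z.2))

/-- The `d × K` matrix whose column with index `k` is `U(k, x; β)`. -/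
def UMatrix {K d : ℕ} {𝒳 : Type*}
    (U : Fin K → 𝒳 → EuclideanSpace ℝ (Fin d) → EuclideanSpace ℝ (Fin d))
    (x : 𝒳) (β : EuclideanSpace ℝ (Fin d)) : Matrix (Fin d) (Fin K) ℝ :=
  Matrix.of fun a k => U k x β a

/-- `φ(i, x; β) = 𝕌(x; β) P⁻¹ e_i`, as a function of `z = (i, x)`. -/
def phi {K d : ℕ} {𝒳 : Type*} (P : Matrix (Fin K) (Fin K) ℝ)
    (U : Fin K → 𝒳 → EuclideanSpace ℝ (Fin d) → EuclideanSpace ℝ (Fin d))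
    (β : EuclideanSpace ℝ (Fin d)) (z : Fin K × 𝒳) : EuclideanSpace ℝ (Fin d) :=
  WithLp.toLp 2 ((UMatrix U z.2 β * P⁻¹) *ᵥ Pi.single z.1 1)

/-- `Ω = E_μ {∂U(Y, X; β) / ∂βᵀ}`. -/
def Omega {K d : ℕ} {𝒳 : Type*} [MeasurableSpace 𝒳]
    (U : Fin K → 𝒳 → EuclideanSpace ℝ (Fin d) → EuclideanSpace ℝ (Fin d))
    (μ : Measure (Fin K × 𝒳)) (β : EuclideanSpace ℝ (Fin d)) : Matrix (Fin d) (Fin d) ℝ :=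
  Matrix.of fun a b =>
    ∫ z, fderiv ℝ (U z.1 z.2) β (EuclideanSpace.single b 1) a ∂μ

/-- `E_μ {U(Y, X; β)} = 0`, the expectation being well defined. -/
def SolvesEstimatingEq {K d : ℕ} {𝒳 : Type*} [MeasurableSpace 𝒳]
    (U : Fin K → 𝒳 → EuclideanSpace ℝ (Fin d) → EuclideanSpace ℝ (Fin d))
    (μ : Measure (Fin K × 𝒳)) (β : EuclideanSpace ℝ (Fin d)) : Prop :=
  Integrable (fun z => U z.1 z.2 β) μ ∧ ∫ z, U z.1 z.2 β ∂μ = 0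

/-- `M` is a measurable bound of `∂U/∂βᵀ`, uniform in some neighbourhood of `β₀`. -/
def IsJacobianEnvelope {K d : ℕ} {𝒳 : Type*} [MeasurableSpace 𝒳]
    (U : Fin K → 𝒳 → EuclideanSpace ℝ (Fin d) → EuclideanSpace ℝ (Fin d))
    (β₀ : EuclideanSpace ℝ (Fin d)) (M : Fin K × 𝒳 → ℝ) : Prop :=
  Measurable M ∧ ∃ N ∈ 𝓝 β₀, ∀ β ∈ N, ∀ z : Fin K × 𝒳, ‖fderiv ℝ (U z.1 z.2) β‖ ≤ M z

/-- A path `t ↦ μ t`, `t ≥ 0`, of otherwise arbitrary laws of `(Y, X)` through `μ₀` along which the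
moments stay under control: near `t = 0` the second moment of `φ(Y*, X; β₀)` is bounded, and some
integrable envelope of the Jacobian of `U` has a mean that is continuous at `t = 0`. -/
def IsRegularPath {K d : ℕ} {𝒳 : Type*} [MeasurableSpace 𝒳] (P : Matrix (Fin K) (Fin K) ℝ)
    (U : Fin K → 𝒳 → EuclideanSpace ℝ (Fin d) → EuclideanSpace ℝ (Fin d))
    (μ₀ : Measure (Fin K × 𝒳)) (β₀ : EuclideanSpace ℝ (Fin d))
    (μ : ℝ → Measure (Fin K × 𝒳)) : Prop :=
  (∀ t, IsProbabilityMeasure (μ t)) ∧ μ 0 = μ₀ ∧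
  (∃ C : ℝ≥0, ∀ᶠ t in 𝓝[≥] 0, ∫⁻ z, ‖phi P U β₀ z‖ₑ ^ 2 ∂(obsLaw P (μ t)) ≤ C) ∧
  ∃ M, IsJacobianEnvelope U β₀ M ∧ Integrable M μ₀ ∧
    Tendsto (fun t => ∫⁻ z, ENNReal.ofReal (M z) ∂(μ t)) (𝓝[≥] 0)
      (𝓝 (∫⁻ z, ENNReal.ofReal (M z) ∂μ₀))

/-- `b t` is the parameter value at `μ t` for small `t ≥ 0`: the solution of the estimating
equation that starts from `β₀`. -/
def IsParameterCurve {K d : ℕ} {𝒳 : Type*} [MeasurableSpace 𝒳]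
    (U : Fin K → 𝒳 → EuclideanSpace ℝ (Fin d) → EuclideanSpace ℝ (Fin d))
    (β₀ : EuclideanSpace ℝ (Fin d)) (μ : ℝ → Measure (Fin K × 𝒳))
    (b : ℝ → EuclideanSpace ℝ (Fin d)) : Prop :=
  b 0 = β₀ ∧ ContinuousWithinAt b (Ici 0) 0 ∧ ∀ᶠ t in 𝓝[≥] 0, SolvesEstimatingEq U (μ t) (b t)

/-- The one-dimensional submodels of the model for the observed `(Y*, X)`: the law of `(Y, X)`
varies freely, the transition matrix `P` is fixed. -/
def pramSubmodels {K d : ℕ} {𝒳 : Type*} [MeasurableSpace 𝒳] (P : Matrix (Fin K) (Fin K) ℝ)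
    (U : Fin K → 𝒳 → EuclideanSpace ℝ (Fin d) → EuclideanSpace ℝ (Fin d))
    (μ₀ : Measure (Fin K × 𝒳)) (β₀ : EuclideanSpace ℝ (Fin d)) :
    Set ((ℝ → Measure (Fin K × 𝒳)) × (ℝ → EuclideanSpace ℝ (Fin d))) :=
  {s | ∃ μ, IsRegularPath P U μ₀ β₀ μ ∧ (∀ t, s.1 t = obsLaw P (μ t)) ∧
    IsParameterCurve U β₀ μ s.2}

end

/-! Since `P` is invertible, every function `u` of `(Y, X)` is the conditional mean, given `(Y, X)`,
of an explicit function `invMean P u` of `(Y*, X)`. Hence `E_μ u` is a mean under the observed law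
for every `μ` (`integrable_of_invMean`), and in particular `E_μ U(β) = E_Q φ(β)`. This turns
information about the observed path into information about the hidden one.

Derivative. Along a path with score `g`, means of functions with bounded second moments have
derivative `∫ f g dQ₀` (`HasScore.tendsto_slope_integral`). For `f = φ(β₀)` this differentiates
`E_{μ_t} U(β₀)`. For the bounded functions that represent indicators it shows that `μ_t` converges
setwise to `μ₀`. Setwise convergence and convergence of the envelope's mean give a dominated
convergence theorem with moving measures, so `β ↦ E_{μ_t} U(β)` is strictly differentiable at `β₀`
with derivative `Ω`, uniformly for small `t` (`eventually_norm_integral_sub_le`). An inverse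
function argument then gives the curve `β_t`, its uniqueness and its derivative `-Ω⁻¹ ∫ φ g dQ₀`.

Efficiency. Mixing `μ₀` with a law `ν` whose observed law `R` satisfies `R ≤ c Q₀` and under which
the envelope is integrable gives the score `dR/dQ₀ - 1`. If `f` is orthogonal to all scores, the
conditional mean of `f` given `(Y, X)` therefore has the same mean under all these `ν`. There are
enough of them to force this conditional mean to be constant, and invertibility of `P` then makes
`f` itself constant (`ae_eq_const_of_mem_orthogonal`). As `ψ` has mean zero, it is orthogonal to
every such `f`, so it lies in the closed span of the scores. -/

/-! ### Transfer of means between the hidden and the observed law -/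

section ObservedLaw

variable {K : ℕ} {𝒳 : Type*} [MeasurableSpace 𝒳]

theorem measurableSet_fst_eq (j : Fin K) : MeasurableSet {z : Fin K × 𝒳 | z.1 = j} :=
  measurable_fst (measurableSet_singleton j)

theorem lintegral_eq_sum_restrict_fst (μ : Measure (Fin K × 𝒳)) (f : Fin K × 𝒳 → ℝ≥0∞) :
    ∫⁻ z, f z ∂μ = ∑ j, ∫⁻ z in {z | z.1 = j}, f (j, z.2) ∂μ := by
  have h : ∀ j : Fin K, ∫⁻ z in {z | z.1 = j}, f (j, z.2) ∂μ = ∫⁻ z in {z | z.1 = j}, f z ∂μ := by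
    intro j
    refine setLIntegral_congr_fun (measurableSet_fst_eq j) ?_
    rintro ⟨i, x⟩ rfl
    rfl
  simp_rw [h]
  rw [← lintegral_finsetSum_measure]
  congr 1
  rw [← Measure.sum_fintype, ← Measure.restrict_iUnion _ (fun j => measurableSet_fst_eq j)]
  · have : (⋃ j : Fin K, {z : Fin K × 𝒳 | z.1 = j}) = univ := by ext; simp
    rw [this, Measure.restrict_univ]
  · intro i j hij
    refine Set.disjoint_left.2 fun z (hi : z.1 = i) (hj : z.1 = j) => hij (hi.symm.trans hj)

theorem lintegral_obsLaw (P : Matrix (Fin K) (Fin K) ℝ) (μ : Measure (Fin K × 𝒳))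
    {f : Fin K × 𝒳 → ℝ≥0∞} (hf : Measurable f) :
    ∫⁻ z, f z ∂(obsLaw P μ) = ∫⁻ z, ∑ i, ENNReal.ofReal (P i z.1) * f (i, z.2) ∂μ := by
  have hfi : ∀ i, Measurable fun z : Fin K × 𝒳 => f (i, z.2) := fun i => by fun_prop
  rw [lintegral_eq_sum_restrict_fst μ, obsLaw, lintegral_finsetSum_measure]
  simp_rw [lintegral_finsetSum_measure, lintegral_smul_measure]
  rw [Finset.sum_comm]
  refine Finset.sum_congr rfl fun j _ => ?_
  rw [lintegral_finsetSum _ fun i _ => (hfi i).const_mul _]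
  refine Finset.sum_congr rfl fun i _ => ?_
  rw [lintegral_map hf (by fun_prop), lintegral_const_mul _ (hfi i), smul_eq_mul]

theorem isProbabilityMeasure_obsLaw {P : Matrix (Fin K) (Fin K) ℝ} (hP : IsTransitionMatrix P)
    (μ : Measure (Fin K × 𝒳)) [IsProbabilityMeasure μ] : IsProbabilityMeasure (obsLaw P μ) := by
  refine ⟨?_⟩
  rw [← lintegral_one, lintegral_obsLaw P μ measurable_const]
  have : ∀ j, ∑ i, ENNReal.ofReal (P i j) = 1 := fun j => by
    rw [← ENNReal.ofReal_sum_of_nonneg fun i _ => hP.1 i j, hP.2 j, ENNReal.ofReal_one]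
  simp [this]

/-- The conditional expectation of `f (Y*, X)` given `(Y, X)`. -/
noncomputable def condMean (P : Matrix (Fin K) (Fin K) ℝ) (f : Fin K × 𝒳 → ℝ)
    (z : Fin K × 𝒳) : ℝ :=
  ∑ i, P i z.1 * f (i, z.2)

theorem measurable_coe_matrix (P : Matrix (Fin K) (Fin K) ℝ) (i : Fin K) :
    Measurable fun z : Fin K × 𝒳 => P i z.1 :=
  (measurable_of_countable (P i)).comp measurable_fst

theorem measurable_condMean (P : Matrix (Fin K) (Fin K) ℝ) {f : Fin K × 𝒳 → ℝ}
    (hf : Measurable f) : Measurable (condMean P f) :=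
  Finset.measurable_fun_sum _ fun i _ => (measurable_coe_matrix P i).mul (by fun_prop)

omit [MeasurableSpace 𝒳] in
theorem ofReal_condMean {P : Matrix (Fin K) (Fin K) ℝ} (hP : IsTransitionMatrix P)
    {f : Fin K × 𝒳 → ℝ} (hf : 0 ≤ f) (z : Fin K × 𝒳) :
    ENNReal.ofReal (condMean P f z)
      = ∑ i, ENNReal.ofReal (P i z.1) * ENNReal.ofReal (f (i, z.2)) := by
  rw [condMean, ENNReal.ofReal_sum_of_nonneg fun i _ => mul_nonneg (hP.1 _ _) (hf _)]
  exact Finset.sum_congr rfl fun i _ => ENNReal.ofReal_mul (hP.1 _ _)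

omit [MeasurableSpace 𝒳] in
theorem condMean_nonneg {P : Matrix (Fin K) (Fin K) ℝ} (hP : IsTransitionMatrix P)
    {f : Fin K × 𝒳 → ℝ} (hf : 0 ≤ f) : 0 ≤ condMean P f := fun _ =>
  Finset.sum_nonneg fun _ _ => mul_nonneg (hP.1 _ _) (hf _)

/-- For nonnegative functions the tower property is an identity of lower integrals, so integrability
comes with it; the signed case follows by positive and negative parts. -/
theorem integrable_condMean_of_nonneg {P : Matrix (Fin K) (Fin K) ℝ} (hP : IsTransitionMatrix P)
    {μ : Measure (Fin K × 𝒳)} {f : Fin K × 𝒳 → ℝ} (hf : Measurable f) (hf0 : 0 ≤ f)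
    (hfi : Integrable f (obsLaw P μ)) :
    Integrable (condMean P f) μ ∧ ∫ z, condMean P f z ∂μ = ∫ z, f z ∂(obsLaw P μ) := by
  have h : ∫⁻ z, ENNReal.ofReal (f z) ∂(obsLaw P μ)
      = ∫⁻ z, ENNReal.ofReal (condMean P f z) ∂μ := by
    rw [lintegral_obsLaw P μ hf.ennreal_ofReal]
    simp_rw [ofReal_condMean hP hf0]
  constructor
  · refine ⟨(measurable_condMean P hf).aestronglyMeasurable, ?_⟩
    rw [hasFiniteIntegral_iff_ofReal (.of_forall (condMean_nonneg hP hf0)), ← h,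
      ← hasFiniteIntegral_iff_ofReal (.of_forall hf0)]
    exact hfi.2
  · rw [integral_eq_lintegral_of_nonneg_ae (.of_forall (condMean_nonneg hP hf0))
      (measurable_condMean P hf).aestronglyMeasurable,
      integral_eq_lintegral_of_nonneg_ae (.of_forall hf0) hf.aestronglyMeasurable, h]

theorem integrable_condMean {P : Matrix (Fin K) (Fin K) ℝ} (hP : IsTransitionMatrix P)
    {μ : Measure (Fin K × 𝒳)} {f : Fin K × 𝒳 → ℝ} (hf : Measurable f)
    (hfi : Integrable f (obsLaw P μ)) :
    Integrable (condMean P f) μ ∧ ∫ z, condMean P f z ∂μ = ∫ z, f z ∂(obsLaw P μ) := by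
  have h1 := integrable_condMean_of_nonneg hP (f := fun z => max (f z) 0) (by fun_prop)
    (fun z => le_max_right _ _) hfi.pos_part
  have h2 := integrable_condMean_of_nonneg hP (f := fun z => max (-f z) 0) (by fun_prop)
    (fun z => le_max_right _ _) hfi.neg_part
  have hs : ∀ z, f z = max (f z) 0 - max (-f z) 0 := fun z => by
    rcases le_total 0 (f z) with h | h <;> simp [h]
  have hc : condMean P f = fun z => condMean P (fun z => max (f z) 0) z
      - condMean P (fun z => max (-f z) 0) z := by
    funext z
    simp only [condMean]
    rw [← Finset.sum_sub_distrib]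
    refine Finset.sum_congr rfl fun i _ => ?_
    rw [← mul_sub, ← hs]
  constructor
  · rw [hc]
    exact h1.1.sub h2.1
  · rw [hc, integral_sub h1.1 h2.1, h1.2, h2.2, ← integral_sub hfi.pos_part hfi.neg_part]
    exact integral_congr_ae (.of_forall fun z => (hs z).symm)

/-- The function of `(Y*, X)` whose conditional mean given `(Y, X)` is `u (Y, X)`. -/
noncomputable def invMean (P : Matrix (Fin K) (Fin K) ℝ) (u : Fin K × 𝒳 → ℝ)
    (z : Fin K × 𝒳) : ℝ :=
  ∑ k, u (k, z.2) * P⁻¹ k z.1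

theorem measurable_invMean (P : Matrix (Fin K) (Fin K) ℝ) {u : Fin K × 𝒳 → ℝ}
    (hu : Measurable u) : Measurable (invMean P u) :=
  Finset.measurable_fun_sum _ fun i _ =>
    Measurable.mul (by fun_prop) (measurable_coe_matrix P⁻¹ i)

-- Misclassification acts on each fibre over `x` as multiplication by `P`, and `P⁻¹ P = 1` undoes
-- it.
omit [MeasurableSpace 𝒳] in
theorem condMean_invMean {P : Matrix (Fin K) (Fin K) ℝ} (hP : IsUnit P.det)
    (u : Fin K × 𝒳 → ℝ) : condMean P (invMean P u) = u := by
  funext z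
  have h : ∀ k, ∑ i, P⁻¹ k i * P i z.1 = (1 : Matrix (Fin K) (Fin K) ℝ) k z.1 := fun k => by
    rw [← Matrix.nonsing_inv_mul P hP, Matrix.mul_apply]
  simp only [condMean, invMean, Finset.mul_sum]
  rw [Finset.sum_comm]
  have : ∀ k, ∑ i, P i z.1 * (u (k, z.2) * P⁻¹ k i)
      = u (k, z.2) * (1 : Matrix (Fin K) (Fin K) ℝ) k z.1 := fun k => by
    rw [← h k, Finset.mul_sum]
    exact Finset.sum_congr rfl fun i _ => by ring
  simp_rw [this, Matrix.one_apply]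
  simp

/-- The representing function does not depend on `μ`, so the identity can be used along a whole path
of laws. -/
theorem integrable_of_invMean {P : Matrix (Fin K) (Fin K) ℝ} (hP : IsTransitionMatrix P)
    (hPdet : IsUnit P.det) {μ : Measure (Fin K × 𝒳)} {u : Fin K × 𝒳 → ℝ} (hu : Measurable u)
    (hi : Integrable (invMean P u) (obsLaw P μ)) :
    Integrable u μ ∧ ∫ z, u z ∂μ = ∫ z, invMean P u z ∂(obsLaw P μ) := by
  have := integrable_condMean hP (measurable_invMean P hu) hi
  rwa [condMean_invMean hPdet] at this

end ObservedLaw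

/-! ### Differentiating means along a path with a score -/

section Scores

variable {Z : Type*} [MeasurableSpace Z]

/-- Here `a` and `b` stand for `√dQ_t` and `√dQ₀`, and `r` is the error in the definition of the
score. The left side equals `r f (a + b) + (1/2) f g b (a - b)`. Young's inequality with weight `η`
handles the first product. In the second, `a - b = t (r + g b / 2)` gains a factor `t` where `|f| ≤
c`; where `|f| > c`, Young's inequality leaves a tail of `g²`. -/
theorem abs_linearization_remainder_le {a b f g t η c : ℝ} (ht : 0 < t) (hη : 0 < η)
    (hc : 0 ≤ c) :
    |f * (a ^ 2 - b ^ 2) / t - f * g * b ^ 2| ≤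
      ((a - b) / t - 1 / 2 * g * b) ^ 2 / (2 * η) + 3 / 2 * η * (f ^ 2 * a ^ 2 + f ^ 2 * b ^ 2)
        + c * t / 2 * (g ^ 2 * b ^ 2 + ((a - b) / t - 1 / 2 * g * b) ^ 2)
        + (if c < |f| then g ^ 2 else 0) * b ^ 2 / (4 * η) := by
  set r := (a - b) / t - 1 / 2 * g * b with hr
  have hab : a - b = t * (r + 1 / 2 * g * b) := by rw [hr]; field_simp; ring
  have young : ∀ x y : ℝ, |x * y| ≤ x ^ 2 / (2 * η) + η / 2 * y ^ 2 := fun x y => by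
    have h : 0 ≤ (|x| - η * |y|) ^ 2 / (2 * η) := by positivity
    have e : (|x| - η * |y|) ^ 2 / (2 * η)
        = |x| ^ 2 / (2 * η) + η / 2 * |y| ^ 2 - |x| * |y| := by field_simp; ring
    rw [e, sq_abs, sq_abs] at h
    rw [abs_mul]
    linarith
  have key : f * (a ^ 2 - b ^ 2) / t - f * g * b ^ 2
      = r * (f * (a + b)) + 1 / 2 * (f * g * b * (a - b)) := by
    have : f * (a ^ 2 - b ^ 2) / t = f * (r + 1 / 2 * g * b) * (a + b) := by
      have : f * (a ^ 2 - b ^ 2) = t * (f * (r + 1 / 2 * g * b) * (a + b)) := by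
        linear_combination f * (a + b) * hab
      rw [this]; field_simp
    rw [this]; ring
  have h1 := young r (f * (a + b))
  have h1' : η / 2 * (f * (a + b)) ^ 2 ≤ η * (f ^ 2 * a ^ 2 + f ^ 2 * b ^ 2) := by
    nlinarith [mul_nonneg hη.le (sq_nonneg (f * (a - b)))]
  have h2 : |f * g * b * (a - b)| ≤ c * t * (g ^ 2 * b ^ 2 + r ^ 2)
      + ((if c < |f| then g ^ 2 else 0) * b ^ 2 / (2 * η)
        + η * (f ^ 2 * a ^ 2 + f ^ 2 * b ^ 2)) := by
    split_ifs with hcf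
    · have h3 := young (g * b) (f * (a - b))
      have h3' : η / 2 * (f * (a - b)) ^ 2 ≤ η * (f ^ 2 * a ^ 2 + f ^ 2 * b ^ 2) := by
        nlinarith [mul_nonneg hη.le (sq_nonneg (f * (a + b)))]
      have h4 : 0 ≤ c * t * (g ^ 2 * b ^ 2 + r ^ 2) := by positivity
      rw [show f * g * b * (a - b) = g * b * (f * (a - b)) by ring]
      rw [mul_pow g b] at h3
      linarith
    · push Not at hcf
      have h4 : |g * b * (r + 1 / 2 * g * b)| ≤ g ^ 2 * b ^ 2 + r ^ 2 := by
        rw [abs_le]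
        constructor <;> nlinarith [sq_nonneg (g * b + r), sq_nonneg (g * b - r),
          sq_nonneg (g * b), sq_nonneg r]
      have h5 : |f * g * b * (a - b)| = |f| * (t * |g * b * (r + 1 / 2 * g * b)|) := by
        rw [hab, show f * g * b * (t * (r + 1 / 2 * g * b))
          = f * (t * (g * b * (r + 1 / 2 * g * b))) by ring, abs_mul, abs_mul t, abs_of_pos ht]
      have h6 : |f| * (t * |g * b * (r + 1 / 2 * g * b)|) ≤ c * (t * (g ^ 2 * b ^ 2 + r ^ 2)) := by
        gcongr
      have h7 : 0 ≤ η * (f ^ 2 * a ^ 2 + f ^ 2 * b ^ 2) := by positivity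
      rw [h5]
      have h8 : (0 : ℝ) * b ^ 2 / (2 * η) = 0 := by simp
      rw [h8]
      linarith
  rw [key]
  have h9 : (if c < |f| then g ^ 2 else 0) * b ^ 2 / (4 * η)
      = 1 / 2 * ((if c < |f| then g ^ 2 else 0) * b ^ 2 / (2 * η)) := by field_simp; ring
  calc |r * (f * (a + b)) + 1 / 2 * (f * g * b * (a - b))|
      ≤ |r * (f * (a + b))| + 1 / 2 * |f * g * b * (a - b)| := by
        refine (abs_add_le _ _).trans_eq ?_
        rw [abs_mul (1 / 2 : ℝ)]; norm_num
    _ ≤ _ := by rw [h9]; linarith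

/-- Quadratic-mean remainder of the score expansion at parameter `t`. -/
noncomputable def scoreRemainder (Q₀ Qt : Measure Z) (g : Z → ℝ) (t : ℝ) : ℝ≥0∞ :=
  ∫⁻ z, ENNReal.ofReal
      (((√(Qt.rnDeriv (Q₀ + Qt) z).toReal - √(Q₀.rnDeriv (Q₀ + Qt) z).toReal) / t
        - (1 / 2) * g z * √(Q₀.rnDeriv (Q₀ + Qt) z).toReal) ^ 2) ∂(Q₀ + Qt)

theorem abs_slope_integral_sub_le {Q₀ Qt : Measure Z} [IsFiniteMeasure Q₀] [IsFiniteMeasure Qt]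
    {f g : Z → ℝ} (hfm : Measurable f) (hgm : Measurable g) (hf0 : MemLp f 2 Q₀)
    (hft : MemLp f 2 Qt) (hg : MemLp g 2 Q₀) {t η c : ℝ} (ht : 0 < t) (hη : 0 < η) (hc : 0 ≤ c)
    (hR : scoreRemainder Q₀ Qt g t ≠ ∞) :
    |(∫ z, f z ∂Qt - ∫ z, f z ∂Q₀) / t - ∫ z, f z * g z ∂Q₀| ≤
      (scoreRemainder Q₀ Qt g t).toReal / (2 * η)
        + 3 / 2 * η * (∫ z, f z ^ 2 ∂Qt + ∫ z, f z ^ 2 ∂Q₀)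
        + c * t / 2 * (∫ z, g z ^ 2 ∂Q₀ + (scoreRemainder Q₀ Qt g t).toReal)
        + (∫ z, (if c < |f z| then g z ^ 2 else 0) ∂Q₀) / (4 * η) := by
  set m := Q₀ + Qt with hm
  set a : Z → ℝ := fun z => √(Qt.rnDeriv m z).toReal with ha
  set b : Z → ℝ := fun z => √(Q₀.rnDeriv m z).toReal with hb
  have h0m : Q₀ ≪ m := Measure.absolutelyContinuous_of_le (Measure.le_add_right le_rfl)
  have htm : Qt ≪ m := Measure.absolutelyContinuous_of_le (Measure.le_add_left le_rfl)
  have ham : Measurable a := (Measure.measurable_rnDeriv _ _).ennreal_toReal.sqrt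
  have hbm : Measurable b := (Measure.measurable_rnDeriv _ _).ennreal_toReal.sqrt
  have ha2 : ∀ z, a z ^ 2 = (Qt.rnDeriv m z).toReal := fun z => Real.sq_sqrt ENNReal.toReal_nonneg
  have hb2 : ∀ z, b z ^ 2 = (Q₀.rnDeriv m z).toReal := fun z => Real.sq_sqrt ENNReal.toReal_nonneg
  have It : ∀ h : Z → ℝ, ∫ z, h z * a z ^ 2 ∂m = ∫ z, h z ∂Qt := fun h => by
    rw [← integral_rnDeriv_smul htm]
    simp_rw [ha2, smul_eq_mul, mul_comm]
  have I0 : ∀ h : Z → ℝ, ∫ z, h z * b z ^ 2 ∂m = ∫ z, h z ∂Q₀ := fun h => by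
    rw [← integral_rnDeriv_smul h0m]
    simp_rw [hb2, smul_eq_mul, mul_comm]
  have Jt : ∀ h : Z → ℝ, Integrable h Qt → Integrable (fun z => h z * a z ^ 2) m := fun h hh => by
    have := (integrable_rnDeriv_smul_iff htm).2 hh
    simp_rw [smul_eq_mul] at this
    simp_rw [ha2]
    exact this.congr (.of_forall fun z => mul_comm _ _)
  have J0 : ∀ h : Z → ℝ, Integrable h Q₀ → Integrable (fun z => h z * b z ^ 2) m := fun h hh => by
    have := (integrable_rnDeriv_smul_iff h0m).2 hh
    simp_rw [smul_eq_mul] at this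
    simp_rw [hb2]
    exact this.congr (.of_forall fun z => mul_comm _ _)
  set r : Z → ℝ := fun z => (a z - b z) / t - 1 / 2 * g z * b z with hr
  have hrm : Measurable r := by fun_prop
  have hRr : scoreRemainder Q₀ Qt g t = ∫⁻ z, ENNReal.ofReal (r z ^ 2) ∂m := rfl
  have hri : Integrable (fun z => r z ^ 2) m := by
    refine ⟨(hrm.pow_const 2).aestronglyMeasurable, ?_⟩
    rw [hasFiniteIntegral_iff_ofReal (.of_forall fun z => sq_nonneg _), ← hRr]
    exact hR.lt_top
  have hRe : (scoreRemainder Q₀ Qt g t).toReal = ∫ z, r z ^ 2 ∂m := by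
    rw [hRr, integral_eq_lintegral_of_nonneg_ae (.of_forall fun z => sq_nonneg _)
      hri.aestronglyMeasurable]
  have hfit := hft.integrable one_le_two
  have hfi0 := hf0.integrable one_le_two
  have hfg : Integrable (fun z => f z * g z) Q₀ := hf0.integrable_mul hg
  have hcm : Measurable fun z => if c < |f z| then g z ^ 2 else 0 :=
    Measurable.ite (measurableSet_lt measurable_const (by fun_prop)) (by fun_prop)
      measurable_const
  have hgc : Integrable (fun z => if c < |f z| then g z ^ 2 else 0) Q₀ := by
    refine hg.integrable_sq.mono' hcm.aestronglyMeasurable (.of_forall fun z => ?_)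
    split_ifs
    · simp
    · simp [sq_nonneg]
  have e : (∫ z, f z ∂Qt - ∫ z, f z ∂Q₀) / t - ∫ z, f z * g z ∂Q₀
      = ∫ z, (f z * (a z ^ 2 - b z ^ 2) / t - f z * g z * b z ^ 2) ∂m := by
    have i0 : Integrable (fun z => (f z * a z ^ 2 - f z * b z ^ 2) / t) m :=
      ((Jt _ hfit).sub (J0 _ hfi0)).div_const t
    rw [← It, ← I0, ← I0, ← integral_sub (Jt _ hfit) (J0 _ hfi0), ← integral_div,
      ← integral_sub i0 (J0 _ hfg)]
    congr 1; funext z; ring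
  rw [e, hRe, ← It, ← I0, ← I0 (fun z => g z ^ 2), ← I0 (fun z => if c < |f z| then g z ^ 2 else 0)]
  have i1 : Integrable (fun z => r z ^ 2 / (2 * η)) m := hri.div_const (2 * η)
  have i2 : Integrable (fun z => 3 / 2 * η * (f z ^ 2 * a z ^ 2 + f z ^ 2 * b z ^ 2)) m :=
    ((Jt _ hft.integrable_sq).add (J0 _ hf0.integrable_sq)).const_mul (3 / 2 * η)
  have i3 : Integrable (fun z => c * t / 2 * (g z ^ 2 * b z ^ 2 + r z ^ 2)) m :=
    ((J0 _ hg.integrable_sq).add hri).const_mul (c * t / 2)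
  have i4 : Integrable (fun z => (if c < |f z| then g z ^ 2 else 0) * b z ^ 2 / (4 * η)) m :=
    (J0 _ hgc).div_const (4 * η)
  have i12 : Integrable (fun z => r z ^ 2 / (2 * η)
      + 3 / 2 * η * (f z ^ 2 * a z ^ 2 + f z ^ 2 * b z ^ 2)) m := i1.add i2
  have i123 : Integrable (fun z => r z ^ 2 / (2 * η)
      + 3 / 2 * η * (f z ^ 2 * a z ^ 2 + f z ^ 2 * b z ^ 2)
      + c * t / 2 * (g z ^ 2 * b z ^ 2 + r z ^ 2)) m := i12.add i3
  rw [← integral_add (Jt _ hft.integrable_sq) (J0 _ hf0.integrable_sq),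
    ← integral_add (J0 _ hg.integrable_sq) hri, ← integral_div, ← integral_div,
    ← integral_const_mul, ← integral_const_mul, ← integral_add i1 i2,
    ← integral_add i12 i3, ← integral_add i123 i4]
  refine (abs_integral_le_integral_abs).trans ?_
  refine integral_mono_of_nonneg (.of_forall fun z => abs_nonneg _)
    (i123.add i4) (.of_forall fun z => ?_)
  exact abs_linearization_remainder_le ht hη hc

theorem tendsto_integral_ite_lt_abs {Q₀ : Measure Z} {f g : Z → ℝ} (hfm : Measurable f)
    (hgm : Measurable g) (hg : MemLp g 2 Q₀) :
    Tendsto (fun n : ℕ => ∫ z, (if (n : ℝ) < |f z| then g z ^ 2 else 0) ∂Q₀) atTop (𝓝 0) := by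
  have h := tendsto_integral_of_dominated_convergence (μ := Q₀)
    (F := fun (n : ℕ) z => if (n : ℝ) < |f z| then g z ^ 2 else 0) (f := fun _ => 0)
    (fun z => g z ^ 2)
    (fun n => (Measurable.ite (measurableSet_lt measurable_const (by fun_prop)) (by fun_prop)
      measurable_const).aestronglyMeasurable) hg.integrable_sq
    (fun n => .of_forall fun z => by split_ifs <;> simp [sq_nonneg])
    (.of_forall fun z => ?_)
  · simpa using h
  · refine tendsto_const_nhds.congr' ?_
    filter_upwards [eventually_ge_atTop ⌈|f z|⌉₊] with n hn
    rw [if_neg (not_lt.2 (Nat.ceil_le.1 hn))]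

/-- Means of square-integrable functions are differentiable along a path with a score. -/
theorem HasScore.tendsto_slope_integral {Q₀ : Measure Z} [IsFiniteMeasure Q₀]
    {Q : ℝ → Measure Z} [∀ t, IsFiniteMeasure (Q t)] {f g : Z → ℝ} (hs : HasScore Q₀ Q g)
    (hfm : Measurable f) (hgm : Measurable g) (hf0 : MemLp f 2 Q₀) (hg : MemLp g 2 Q₀) {C : ℝ≥0}
    (hft : ∀ᶠ t in 𝓝[>] 0, ∫⁻ z, ‖f z‖ₑ ^ 2 ∂(Q t) ≤ C) :
    (∀ᶠ t in 𝓝[>] 0, MemLp f 2 (Q t)) ∧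
    Tendsto (fun t => (∫ z, f z ∂(Q t) - ∫ z, f z ∂Q₀) / t) (𝓝[>] 0)
      (𝓝 (∫ z, f z * g z ∂Q₀)) := by
  have hsq : ∀ z, ‖f z‖ₑ ^ 2 = ENNReal.ofReal (f z ^ 2) := fun z => by
    rw [Real.enorm_eq_ofReal_abs, ← ENNReal.ofReal_pow (abs_nonneg _), sq_abs]
  have hmem : ∀ t, ∫⁻ z, ‖f z‖ₑ ^ 2 ∂(Q t) ≤ C → MemLp f 2 (Q t) := fun t ht => by
    rw [memLp_two_iff_integrable_sq hfm.aestronglyMeasurable]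
    refine ⟨(hfm.pow_const 2).aestronglyMeasurable, ?_⟩
    rw [hasFiniteIntegral_iff_ofReal (.of_forall fun z => sq_nonneg _)]
    simp_rw [← hsq]
    exact ht.trans_lt ENNReal.coe_lt_top
  have hle : ∀ t, ∫⁻ z, ‖f z‖ₑ ^ 2 ∂(Q t) ≤ C → ∫ z, f z ^ 2 ∂(Q t) ≤ C := fun t ht => by
    rw [integral_eq_lintegral_of_nonneg_ae (.of_forall fun z => sq_nonneg _)
      (hfm.pow_const 2).aestronglyMeasurable]
    simp_rw [← hsq]
    exact ENNReal.toReal_mono ENNReal.coe_ne_top ht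
  refine ⟨hft.mono hmem, ?_⟩
  have hs' : Tendsto (fun t => scoreRemainder Q₀ (Q t) g t) (𝓝[>] 0) (𝓝 0) := hs
  have hfin : ∀ᶠ t in 𝓝[>] (0 : ℝ), scoreRemainder Q₀ (Q t) g t < ∞ :=
    hs'.eventually (gt_mem_nhds ENNReal.zero_lt_top)
  have hs'' : Tendsto (fun t => (scoreRemainder Q₀ (Q t) g t).toReal) (𝓝[>] 0) (𝓝 0) := by
    simpa [Function.comp_def] using (ENNReal.tendsto_toReal ENNReal.zero_ne_top).comp hs'
  rw [tendsto_iff_dist_tendsto_zero]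
  simp_rw [Real.dist_eq]
  rw [Metric.tendsto_nhds]
  intro ε hε
  set A := ∫ z, f z ^ 2 ∂Q₀
  have hA : 0 ≤ A := integral_nonneg fun z => sq_nonneg _
  have hC : (0 : ℝ) ≤ C := C.2
  -- The order of choices matters: `η` first, using the bound `C` that is uniform in `t`; then the
  -- truncation level `n`, since the tail of `g²` is divided by `η`; and only then `t → 0`.
  obtain ⟨η, hη, hηε⟩ : ∃ η > 0, 3 / 2 * η * (C + A) < ε / 3 := by
    refine ⟨ε / (6 * (C + A + 1)), by positivity, ?_⟩
    rw [show 3 / 2 * (ε / (6 * (C + A + 1))) * (C + A) = ε / 3 * (3 / 4 * ((C + A) / (C + A + 1)))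
      by field_simp; ring]
    have : (C + A) / (C + A + 1) ≤ 1 := by rw [div_le_one (by positivity)]; linarith
    nlinarith
  obtain ⟨n, hn⟩ : ∃ n : ℕ, (∫ z, (if (n : ℝ) < |f z| then g z ^ 2 else 0) ∂Q₀) / (4 * η)
      < ε / 3 := by
    have h := (tendsto_integral_ite_lt_abs hfm hgm hg).div_const (4 * η)
    rw [zero_div] at h
    exact (h.eventually (gt_mem_nhds (by positivity))).exists
  have ht0 : Tendsto (fun t : ℝ => t) (𝓝[>] 0) (𝓝 0) := tendsto_nhdsWithin_of_tendsto_nhds tendsto_id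
  have hlim : Tendsto (fun t => (scoreRemainder Q₀ (Q t) g t).toReal / (2 * η)
      + n * t / 2 * (∫ z, g z ^ 2 ∂Q₀ + (scoreRemainder Q₀ (Q t) g t).toReal))
      (𝓝[>] 0) (𝓝 0) := by
    have := (hs''.div_const (2 * η)).add
      (((ht0.const_mul (n : ℝ)).div_const 2).mul (hs''.const_add (∫ z, g z ^ 2 ∂Q₀)))
    simpa using this
  filter_upwards [hft, hfin, self_mem_nhdsWithin, hlim.eventually (gt_mem_nhds (by positivity :
    0 < ε / 3))] with t h1 h2 h3 h4
  have := abs_slope_integral_sub_le hfm hgm hf0 (hmem t h1) hg h3 hη (Nat.cast_nonneg n) h2.ne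
  have h5 := hle t h1
  have h6 : 3 / 2 * η * (∫ z, f z ^ 2 ∂(Q t) + A) ≤ 3 / 2 * η * (C + A) := by gcongr
  rw [dist_zero_right, Real.norm_eq_abs, abs_abs]
  linarith

end Scores

/-! ### Dominated convergence for setwise convergent measures -/

section SetwiseConvergence

variable {Z ι : Type*} [MeasurableSpace Z] {l : Filter ι} {μs : ι → Measure Z} {μ : Measure Z}

/-- The lower integral is a supremum over simple functions below `f`, and their integrals converge
by hypothesis. No measurability of `f` is needed. -/
theorem lintegral_le_liminf_of_tendsto_measure
    (h : ∀ s, MeasurableSet s → Tendsto (fun i => μs i s) l (𝓝 (μ s))) (f : Z → ℝ≥0∞) :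
    ∫⁻ z, f z ∂μ ≤ liminf (fun i => ∫⁻ z, f z ∂(μs i)) l := by
  rcases l.eq_or_neBot with rfl | hl
  · simp [liminf, limsInf]
  rw [lintegral_eq_nnreal]
  refine iSup₂_le fun φ hφ => ?_
  have ht : Tendsto (fun i => (φ.map ((↑) : ℝ≥0 → ℝ≥0∞)).lintegral (μs i)) l
      (𝓝 ((φ.map ((↑) : ℝ≥0 → ℝ≥0∞)).lintegral μ)) := by
    simp_rw [SimpleFunc.map_lintegral]
    exact tendsto_finsetSum _ fun r _ =>
      ENNReal.Tendsto.const_mul (h _ (φ.measurableSet_fiber r)) (Or.inr ENNReal.coe_ne_top)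
  rw [← ht.liminf_eq]
  refine liminf_le_liminf (.of_forall fun i => ?_)
  rw [← SimpleFunc.lintegral_eq_lintegral]
  exact lintegral_mono fun z => hφ z

/-- Dominated convergence for a fixed integrand and setwise convergent measures. -/
theorem tendsto_lintegral_of_tendsto_measure
    (h : ∀ s, MeasurableSet s → Tendsto (fun i => μs i s) l (𝓝 (μ s))) {f G : Z → ℝ≥0∞}
    (hf : Measurable f) (hfG : f ≤ G) (hGfin : ∫⁻ z, G z ∂μ ≠ ∞)
    (hGlim : Tendsto (fun i => ∫⁻ z, G z ∂(μs i)) l (𝓝 (∫⁻ z, G z ∂μ))) :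
    Tendsto (fun i => ∫⁻ z, f z ∂(μs i)) l (𝓝 (∫⁻ z, f z ∂μ)) := by
  rcases l.eq_or_neBot with rfl | hl
  · exact tendsto_bot
  refine tendsto_of_le_liminf_of_limsup_le (lintegral_le_liminf_of_tendsto_measure h f) ?_
  have hsplit : ∀ ν : Measure Z, ∫⁻ z, f z ∂ν + ∫⁻ z, (G z - f z) ∂ν = ∫⁻ z, G z ∂ν := fun ν => by
    rw [← lintegral_add_left hf]
    exact lintegral_congr fun z => add_tsub_cancel_of_le (hfG z)
  -- As in the classical proof, the upper bound is Fatou's inequality for `G - f`.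
  have hlow := lintegral_le_liminf_of_tendsto_measure h fun z => G z - f z
  set b := ∫⁻ z, (G z - f z) ∂μ
  have hbfin : b ≠ ∞ := ne_top_of_le_ne_top hGfin (by rw [← hsplit μ]; exact le_add_self)
  refine ENNReal.le_of_forall_pos_le_add fun ε hε _ => ?_
  have hε2 : (ε : ℝ≥0∞) / 2 ≠ 0 := by simpa using hε.ne'
  have h1 : ∀ᶠ i in l, ∫⁻ z, G z ∂(μs i) < ∫⁻ z, G z ∂μ + ε / 2 :=
    hGlim.eventually (gt_mem_nhds (ENNReal.lt_add_right hGfin hε2))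
  have h2 : ∀ᶠ i in l, b ≤ ∫⁻ z, (G z - f z) ∂(μs i) + ε / 2 := by
    -- The liminf bound is used through `b - ε / 2 < b`, which fails for `b = 0` in truncated
    -- subtraction.
    rcases eq_or_ne b 0 with hb | hb
    · exact .of_forall fun i => by simp [hb]
    · filter_upwards [eventually_lt_of_lt_liminf
        ((ENNReal.sub_lt_self hbfin hb hε2).trans_le hlow)] with i hi
      exact tsub_le_iff_right.1 hi.le
  refine limsup_le_of_le (by isBoundedDefault) ?_
  filter_upwards [h1, h2] with i hi1 hi2
  have hfin : ∫⁻ z, (G z - f z) ∂(μs i) ≠ ∞ := by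
    refine ne_top_of_le_ne_top (ne_top_of_lt (hi1.trans_le le_top)) ?_
    rw [← hsplit (μs i)]
    exact le_add_self
  refine (ENNReal.add_le_add_iff_right hfin).1 ?_
  calc ∫⁻ z, f z ∂(μs i) + ∫⁻ z, (G z - f z) ∂(μs i)
      ≤ ∫⁻ z, f z ∂μ + b + ε / 2 := by rw [hsplit, hsplit]; exact hi1.le
    _ ≤ ∫⁻ z, f z ∂μ + (∫⁻ z, (G z - f z) ∂(μs i) + ε / 2) + ε / 2 := by gcongr
    _ = ∫⁻ z, f z ∂μ + (ε / 2 + ε / 2) + ∫⁻ z, (G z - f z) ∂(μs i) := by ring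
    _ = _ := by rw [ENNReal.add_halves]

theorem tendsto_integral_of_tendsto_measure
    (h : ∀ s, MeasurableSet s → Tendsto (fun i => μs i s) l (𝓝 (μ s))) {f G : Z → ℝ}
    (hf : Measurable f) (hfG : ∀ z, |f z| ≤ G z)
    (hGfin : ∫⁻ z, ENNReal.ofReal (G z) ∂μ ≠ ∞)
    (hGlim : Tendsto (fun i => ∫⁻ z, ENNReal.ofReal (G z) ∂(μs i)) l
      (𝓝 (∫⁻ z, ENNReal.ofReal (G z) ∂μ))) :
    Tendsto (fun i => ∫ z, f z ∂(μs i)) l (𝓝 (∫ z, f z ∂μ)) := by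
  have hint : ∀ ν : Measure Z, ∫⁻ z, ENNReal.ofReal (G z) ∂ν ≠ ∞ → Integrable f ν := fun ν hν => by
    refine ⟨hf.aestronglyMeasurable, ?_⟩
    rw [hasFiniteIntegral_iff_norm]
    exact (lintegral_mono fun z => ENNReal.ofReal_le_ofReal (hfG z)).trans_lt hν.lt_top
  have hp := tendsto_lintegral_of_tendsto_measure h (f := fun z => ENNReal.ofReal (f z))
    hf.ennreal_ofReal (fun z => ENNReal.ofReal_le_ofReal ((le_abs_self _).trans (hfG z))) hGfin hGlim
  have hn := tendsto_lintegral_of_tendsto_measure h (f := fun z => ENNReal.ofReal (-f z))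
    hf.neg.ennreal_ofReal
    (fun z => ENNReal.ofReal_le_ofReal ((neg_le_abs _).trans (hfG z))) hGfin hGlim
  have hpf : ∫⁻ z, ENNReal.ofReal (f z) ∂μ ≠ ∞ := ne_top_of_le_ne_top hGfin
    (lintegral_mono fun z => ENNReal.ofReal_le_ofReal ((le_abs_self _).trans (hfG z)))
  have hnf : ∫⁻ z, ENNReal.ofReal (-f z) ∂μ ≠ ∞ := ne_top_of_le_ne_top hGfin
    (lintegral_mono fun z => ENNReal.ofReal_le_ofReal ((neg_le_abs _).trans (hfG z)))
  have hfin : ∀ᶠ i in l, ∫⁻ z, ENNReal.ofReal (G z) ∂(μs i) < ∞ :=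
    hGlim.eventually (gt_mem_nhds hGfin.lt_top)
  rw [integral_eq_lintegral_pos_part_sub_lintegral_neg_part (hint μ hGfin)]
  refine (((ENNReal.tendsto_toReal hpf).comp hp).sub
    ((ENNReal.tendsto_toReal hnf).comp hn)).congr' ?_
  filter_upwards [hfin] with i hi
  rw [integral_eq_lintegral_pos_part_sub_lintegral_neg_part (hint _ hi.ne)]
  rfl

/-- Dominated convergence to zero along a sequence of setwise convergent measures. -/
theorem tendsto_lintegral_zero_of_tendsto_measure {μs : ℕ → Measure Z}
    (h : ∀ s, MeasurableSet s → Tendsto (fun n => μs n s) atTop (𝓝 (μ s)))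
    {f : ℕ → Z → ℝ≥0∞} {G : Z → ℝ≥0∞} (hf : ∀ n, Measurable (f n))
    (hfG : ∀ᶠ n in atTop, f n ≤ G) (hf0 : ∀ z, Tendsto (fun n => f n z) atTop (𝓝 0))
    (hGfin : ∫⁻ z, G z ∂μ ≠ ∞)
    (hGlim : Tendsto (fun n => ∫⁻ z, G z ∂(μs n)) atTop (𝓝 (∫⁻ z, G z ∂μ))) :
    Tendsto (fun n => ∫⁻ z, f n z ∂(μs n)) atTop (𝓝 0) := by
  obtain ⟨n₀, hn₀⟩ := eventually_atTop.1 hfG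
  -- The tail suprema `w m` dominate all later `f n` and tend to zero pointwise. With `m` frozen the
  -- integrand no longer moves, so the previous theorem applies; the shift `n₀` keeps `w m` below
  -- `G`.
  set w : ℕ → Z → ℝ≥0∞ := fun m z => ⨆ k, f (m + n₀ + k) z
  have hwm : ∀ m, Measurable (w m) := fun m => Measurable.iSup fun k => hf _
  have hwG : ∀ m, w m ≤ G := fun m z => iSup_le fun k => hn₀ _ (by omega) z
  have hw0 : ∀ z, Tendsto (fun m => w m z) atTop (𝓝 0) := fun z => by
    rw [ENNReal.tendsto_nhds_zero]
    intro ε hε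
    obtain ⟨n₁, hn₁⟩ := eventually_atTop.1 ((ENNReal.tendsto_nhds_zero.1 (hf0 z)) ε hε)
    filter_upwards [eventually_ge_atTop n₁] with m hm
    exact iSup_le fun k => hn₁ _ (by omega)
  have hI : Tendsto (fun m => ∫⁻ z, w m z ∂μ) atTop (𝓝 0) := by
    simpa using tendsto_lintegral_of_dominated_convergence G hwm
      (fun m => .of_forall fun z => hwG m z) hGfin (.of_forall hw0)
  rw [ENNReal.tendsto_nhds_zero]
  intro ε hε
  obtain ⟨m, hm⟩ := (hI.eventually (gt_mem_nhds hε)).exists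
  have hlim := tendsto_lintegral_of_tendsto_measure h (hwm m) (hwG m) hGfin hGlim
  filter_upwards [hlim.eventually (gt_mem_nhds hm), eventually_ge_atTop (m + n₀)] with n h1 h2
  refine (lintegral_mono fun z => ?_).trans h1.le
  obtain ⟨k, rfl⟩ := Nat.exists_eq_add_of_le h2
  exact le_iSup (fun k => f (m + n₀ + k) z) k

end SetwiseConvergence

/-! ### Zeros of maps uniformly close to a linear isomorphism -/

section MovingZero

variable {E ι : Type*} [NormedAddCommGroup E] [NormedSpace ℝ E] {l : Filter ι}
  {F : ι → E → E} {x₀ : E} {L : E ≃L[ℝ] E}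

/-- Maps that are uniformly well approximated near `x₀` by an invertible linear map, and whose
values at `x₀` tend to zero, have eventually exactly one zero near `x₀`. -/
theorem eventually_injOn_and_exists_zero [CompleteSpace E]
    (hF : ∀ ε > 0, ∃ δ > 0, ∀ᶠ t in l, ∀ x ∈ Metric.ball x₀ δ, ∀ y ∈ Metric.ball x₀ δ,
      ‖F t x - F t y - L (x - y)‖ ≤ ε * ‖x - y‖)
    (h0 : Tendsto (fun t => F t x₀) l (𝓝 0)) {s : Set E} (hs : s ∈ 𝓝 x₀) :
    ∃ δ > 0, Metric.ball x₀ δ ⊆ s ∧ ∃ C : ℝ, ∀ᶠ t in l, InjOn (F t) (Metric.ball x₀ δ) ∧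
      ∃ x ∈ Metric.ball x₀ δ, ‖x - x₀‖ ≤ C * ‖F t x₀‖ ∧ F t x = 0 := by
  -- Adding one keeps `N` positive even when `E` is trivial.
  set N : ℝ≥0 := ‖(L.symm : E →L[ℝ] E)‖₊ + 1 with hN
  have hNpos : (0 : ℝ) < N := by positivity
  have hNbound : ∀ y, ‖L.symm y‖ ≤ N * ‖y‖ := fun y => by
    refine ((L.symm : E →L[ℝ] E).le_opNorm y).trans ?_
    gcongr
    simp [hN]
  -- Half of the threshold `1 / N`: this makes the maps injective, and the image of a closed ball of
  -- radius `ρ` contains the one of radius `(1 / N - c) ρ = ρ / (2 N)`. Hence radius `2 N ‖F t x₀‖`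
  -- suffices to reach zero.
  set c : ℝ≥0 := (2 * N)⁻¹ with hc
  obtain ⟨δ₁, hδ₁, hF⟩ := hF c (by positivity)
  obtain ⟨δ₂, hδ₂, hsub⟩ := Metric.mem_nhds_iff.1 hs
  set δ := min δ₁ δ₂ with hδ
  have hδpos : 0 < δ := lt_min hδ₁ hδ₂
  let R : (L : E →L[ℝ] E).NonlinearRightInverse :=
    { toFun := L.symm
      nnnorm := N
      bound' := hNbound
      right_inv' := fun y => L.apply_symm_apply y }
  refine ⟨δ, hδpos, (Metric.ball_subset_ball (min_le_right _ _)).trans hsub, 2 * N, ?_⟩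
  have hsmall : ∀ᶠ t in l, 2 * N * ‖F t x₀‖ < δ := by
    have := h0.norm.const_mul (2 * (N : ℝ))
    rw [norm_zero, mul_zero] at this
    exact this.eventually (gt_mem_nhds hδpos)
  filter_upwards [hF, hsmall] with t ht hst
  have happ : ApproximatesLinearOn (F t) (L : E →L[ℝ] E) (Metric.ball x₀ δ) c := fun x hx y hy =>
    ht x (Metric.ball_subset_ball (min_le_left _ _) hx) y
      (Metric.ball_subset_ball (min_le_left _ _) hy)
  constructor
  · intro x hx y hy hxy
    have h1 := happ x hx y hy
    rw [hxy, sub_self, zero_sub, norm_neg] at h1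
    have h2 := hNbound (L (x - y))
    rw [L.symm_apply_apply] at h2
    have h3 : ‖x - y‖ ≤ 1 / 2 * ‖x - y‖ := by
      calc ‖x - y‖ ≤ N * (c * ‖x - y‖) := h2.trans (by gcongr; exact h1)
        _ = 1 / 2 * ‖x - y‖ := by rw [hc]; push_cast; field_simp
    have h4 : ‖x - y‖ = 0 := by linarith [norm_nonneg (x - y)]
    exact sub_eq_zero.1 (norm_eq_zero.1 h4)
  · have hsurj := happ.surjOn_closedBall_of_nonlinearRightInverse R
      (ε := 2 * N * ‖F t x₀‖) (b := x₀) (by positivity)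
      (Metric.closedBall_subset_ball hst)
    have he : ((R.nnnorm : ℝ)⁻¹ - c) * (2 * N * ‖F t x₀‖) = ‖F t x₀‖ := by
      change ((N : ℝ)⁻¹ - c) * _ = _
      rw [hc]; push_cast; field_simp; norm_num
    rw [he] at hsurj
    obtain ⟨x, hx, hx0⟩ := hsurj (show (0 : E) ∈ _ by simp [dist_eq_norm])
    refine ⟨x, Metric.closedBall_subset_ball hst hx, ?_, hx0⟩
    simpa [dist_eq_norm] using hx

/-- Implicit differentiation: `0 = F t (b t) = F t x₀ + L (b t - x₀) + o(b t - x₀)`, where `F t x₀ =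
t v + o(t)`. This first shows `b t - x₀ = O(t)`, and the error then becomes `o(t)`. No regularity of
`F` in `t` is needed away from `x₀`. -/
theorem hasDerivWithinAt_zero_of_approx {F : ℝ → E → E}
    (hF : ∀ ε > 0, ∃ δ > 0, ∀ᶠ t in 𝓝[>] (0 : ℝ), ∀ x ∈ Metric.ball x₀ δ,
      ∀ y ∈ Metric.ball x₀ δ, ‖F t x - F t y - L (x - y)‖ ≤ ε * ‖x - y‖)
    {v : E} (h0 : Tendsto (fun t => t⁻¹ • F t x₀) (𝓝[>] 0) (𝓝 v)) {b : ℝ → E} (hb0 : b 0 = x₀)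
    (hb : ContinuousWithinAt b (Ici 0) 0) (hbz : ∀ᶠ t in 𝓝[>] 0, F t (b t) = 0) :
    HasDerivWithinAt b (-L.symm v) (Ici 0) 0 := by
  rw [← hasDerivWithinAt_Ioi_iff_Ici, hasDerivWithinAt_iff_tendsto_slope' (by simp)]
  have hbt : Tendsto b (𝓝[>] 0) (𝓝 x₀) := by
    rw [← hb0]
    exact hb.mono_left (nhdsWithin_mono _ Ioi_subset_Ici_self)
  set e : ℝ → E := fun t => F t x₀ + L (b t - x₀) with he
  have heo : e =o[𝓝[>] 0] fun t => b t - x₀ := by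
    rw [Asymptotics.isLittleO_iff]
    intro ε hε
    obtain ⟨δ, hδ, h⟩ := hF ε hε
    filter_upwards [h, hbz, hbt.eventually (Metric.ball_mem_nhds x₀ hδ)] with t h1 h2 h3
    have := h1 _ h3 _ (Metric.mem_ball_self hδ)
    rw [h2, zero_sub, ← norm_neg] at this
    simpa [he, add_comm] using this
  have hFO : (fun t => F t x₀) =O[𝓝[>] 0] fun t : ℝ => t := by
    have h1 := h0.isBigO_one ℝ
    have h2 := (Asymptotics.isBigO_refl (fun t : ℝ => t) (𝓝[>] 0)).smul h1
    refine (h2.congr' ?_ (.of_forall fun t => by simp))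
    filter_upwards [self_mem_nhdsWithin] with t ht
    rw [smul_smul, mul_inv_cancel₀ (ne_of_gt ht), one_smul]
  have hsub : ∀ t, b t - x₀ = L.symm (e t) - L.symm (F t x₀) := fun t => by
    rw [← map_sub, he]; simp
  have hLe : (fun t => L.symm (e t)) =o[𝓝[>] 0] fun t => b t - x₀ :=
    ((L.symm : E →L[ℝ] E).isBigO_comp e _).trans_isLittleO heo
  have hLF : (fun t => L.symm (F t x₀)) =O[𝓝[>] 0] fun t : ℝ => t :=
    ((L.symm : E →L[ℝ] E).isBigO_comp (fun t => F t x₀) _).trans hFO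
  have hbO : (fun t => b t - x₀) =O[𝓝[>] 0] fun t : ℝ => t := by
    -- The error is small relative to `b t - x₀`, so it can be absorbed; what remains is `-L⁻¹ (F t
    -- x₀) = O(t)`.
    have h1 : (fun t => b t - x₀) =O[𝓝[>] 0] fun t => (b t - x₀) - L.symm (e t) :=
      hLe.right_isBigO_sub
    refine h1.trans (hLF.neg_left.congr_left fun t => ?_)
    rw [hsub t]; abel
  have heot : (fun t => t⁻¹ • L.symm (e t)) =o[𝓝[>] 0] fun _ : ℝ => (1 : ℝ) := by
    have h1 := (Asymptotics.isBigO_refl (fun t : ℝ => t⁻¹) (𝓝[>] 0)).smul_isLittleO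
      (hLe.trans_isBigO hbO)
    refine h1.congr' .rfl ?_
    filter_upwards [self_mem_nhdsWithin] with t ht
    rw [smul_eq_mul, inv_mul_cancel₀ (ne_of_gt ht)]
  have hlim := ((Asymptotics.isLittleO_one_iff ℝ).1 heot).sub
    ((L.symm.continuous.tendsto v).comp h0)
  rw [zero_sub] at hlim
  refine hlim.congr fun t => ?_
  rw [slope_def_module, hb0, hsub t, sub_zero, smul_sub]
  simp

end MovingZero

/-! ### Uniform linearization of the mean estimating function -/

section EstimatingFunction

variable {Z : Type*} [MeasurableSpace Z] {d : ℕ}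
  {U : Z → EuclideanSpace ℝ (Fin d) → EuclideanSpace ℝ (Fin d)} {β₀ : EuclideanSpace ℝ (Fin d)}
  {r : ℝ} {M : Z → ℝ}

/-- The mean of the derivative of `U z` at `β`. -/
noncomputable def meanJacobian (U : Z → EuclideanSpace ℝ (Fin d) → EuclideanSpace ℝ (Fin d))
    (μ : Measure Z) (β : EuclideanSpace ℝ (Fin d)) : Matrix (Fin d) (Fin d) ℝ :=
  Matrix.of fun a b => ∫ z, fderiv ℝ (U z) β (EuclideanSpace.single b 1) a ∂μ

omit [MeasurableSpace Z] in
theorem norm_sub_le_of_fderiv_le (hU : ∀ z, ContDiffOn ℝ 1 (U z) (Metric.ball β₀ r))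
    (hM : ∀ β ∈ Metric.ball β₀ r, ∀ z, ‖fderiv ℝ (U z) β‖ ≤ M z) {β β' : EuclideanSpace ℝ (Fin d)}
    (hβ : β ∈ Metric.ball β₀ r) (hβ' : β' ∈ Metric.ball β₀ r) (z : Z) :
    ‖U z β - U z β'‖ ≤ M z * ‖β - β'‖ :=
  (convex_ball β₀ r).norm_image_sub_le_of_norm_fderiv_le (𝕜 := ℝ)
    (fun _ hx => ((hU z).contDiffAt (Metric.isOpen_ball.mem_nhds hx)).differentiableAt one_ne_zero)
    (fun x hx => hM x hx z) hβ' hβ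

/-- The directional derivative is a pointwise limit of measurable difference quotients, so
measurability of `U` in `z` at each fixed `β` is enough. -/
theorem measurable_fderiv_apply (hr : 0 < r) (hUm : ∀ β, Measurable fun z => U z β)
    (hU : ∀ z, ContDiffOn ℝ 1 (U z) (Metric.ball β₀ r)) (v : EuclideanSpace ℝ (Fin d)) :
    Measurable fun z => fderiv ℝ (U z) β₀ v := by
  refine measurable_of_tendsto_metrizable (f := fun (n : ℕ) z =>
    (n : ℝ) • (U z (β₀ + (n : ℝ)⁻¹ • v) - U z β₀))
    (fun n => ((hUm (β₀ + (n : ℝ)⁻¹ • v)).sub (hUm β₀)).const_smul (n : ℝ)) (tendsto_pi_nhds.2 fun z => ?_)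
  have hd : HasFDerivAt (U z) (fderiv ℝ (U z) β₀) β₀ :=
    (((hU z).contDiffAt (Metric.ball_mem_nhds β₀ hr)).differentiableAt one_ne_zero).hasFDerivAt
  refine hd.lim v ?_
  simpa using tendsto_natCast_atTop_atTop (R := ℝ)

theorem integrable_of_fderiv_le (hr : 0 < r) {μ : Measure Z}
    (hUm : ∀ β, Measurable fun z => U z β)
    (hU : ∀ z, ContDiffOn ℝ 1 (U z) (Metric.ball β₀ r)) (hMm : Measurable M)
    (hM : ∀ β ∈ Metric.ball β₀ r, ∀ z, ‖fderiv ℝ (U z) β‖ ≤ M z)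
    (hMfin : ∫⁻ z, ENNReal.ofReal (M z) ∂μ < ∞) (hU0 : Integrable (fun z => U z β₀) μ)
    {β : EuclideanSpace ℝ (Fin d)} (hβ : β ∈ Metric.ball β₀ r) :
    Integrable (fun z => U z β) μ := by
  have hMi : Integrable M μ := by
    refine ⟨hMm.aestronglyMeasurable, ?_⟩
    rwa [hasFiniteIntegral_iff_ofReal (.of_forall fun z =>
      (norm_nonneg _).trans (hM β₀ (Metric.mem_ball_self hr) z))]
  have h1 : Integrable (fun z => U z β - U z β₀) μ :=
    (hMi.mul_const ‖β - β₀‖).mono' ((hUm β).sub (hUm β₀)).aestronglyMeasurable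
      (.of_forall fun z => norm_sub_le_of_fderiv_le hU hM hβ (Metric.mem_ball_self hr) z)
  exact (h1.add hU0).congr (.of_forall fun z => sub_add_cancel _ _)

theorem integrable_fderiv_apply (hr : 0 < r) {μ : Measure Z}
    (hUm : ∀ β, Measurable fun z => U z β)
    (hU : ∀ z, ContDiffOn ℝ 1 (U z) (Metric.ball β₀ r)) (hMm : Measurable M)
    (hM : ∀ β ∈ Metric.ball β₀ r, ∀ z, ‖fderiv ℝ (U z) β‖ ≤ M z)
    (hMfin : ∫⁻ z, ENNReal.ofReal (M z) ∂μ < ∞) (v : EuclideanSpace ℝ (Fin d)) :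
    Integrable (fun z => fderiv ℝ (U z) β₀ v) μ := by
  have hMi : Integrable M μ := by
    refine ⟨hMm.aestronglyMeasurable, ?_⟩
    rwa [hasFiniteIntegral_iff_ofReal (.of_forall fun z =>
      (norm_nonneg _).trans (hM β₀ (Metric.mem_ball_self hr) z))]
  refine (hMi.mul_const ‖v‖).mono' (measurable_fderiv_apply hr hUm hU v).aestronglyMeasurable
    (.of_forall fun z => ?_)
  exact (ContinuousLinearMap.le_opNorm _ _).trans
    (mul_le_mul_of_nonneg_right (hM β₀ (Metric.mem_ball_self hr) z) (norm_nonneg _))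

theorem integral_fderiv_apply (hr : 0 < r) {μ : Measure Z}
    (hUm : ∀ β, Measurable fun z => U z β)
    (hU : ∀ z, ContDiffOn ℝ 1 (U z) (Metric.ball β₀ r)) (hMm : Measurable M)
    (hM : ∀ β ∈ Metric.ball β₀ r, ∀ z, ‖fderiv ℝ (U z) β‖ ≤ M z)
    (hMfin : ∫⁻ z, ENNReal.ofReal (M z) ∂μ < ∞) (v : EuclideanSpace ℝ (Fin d)) :
    ∫ z, fderiv ℝ (U z) β₀ v ∂μ = Matrix.toEuclideanCLM (𝕜 := ℝ) (meanJacobian U μ β₀) v := by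
  have hi := integrable_fderiv_apply hr hUm hU hMm hM hMfin
  have hia : ∀ w a, Integrable (fun z => fderiv ℝ (U z) β₀ w a) μ := fun w a =>
    (EuclideanSpace.proj (𝕜 := ℝ) a).integrable_comp (hi w)
  ext a
  have h1 : (∫ z, fderiv ℝ (U z) β₀ v ∂μ) a = ∫ z, fderiv ℝ (U z) β₀ v a ∂μ :=
    ((EuclideanSpace.proj (𝕜 := ℝ) a).integral_comp_comm (hi v)).symm
  have hv : v = ∑ b, v b • EuclideanSpace.single b (1 : ℝ) := by
    ext i; simp [Pi.single_apply]
  have h2 : ∀ z, fderiv ℝ (U z) β₀ v a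
      = ∑ b, v b * fderiv ℝ (U z) β₀ (EuclideanSpace.single b 1) a := fun z => by
    conv_lhs => rw [hv]
    simp [map_sum]
  simp_rw [h1, h2]
  rw [integral_finsetSum _ fun b _ => (hia _ a).const_mul _]
  simp_rw [integral_const_mul]
  simp [Matrix.mulVec, dotProduct, meanJacobian, mul_comm]

variable {ι : Type*} {l : Filter ι} {μs : ι → Measure Z} {μ : Measure Z}

theorem tendsto_meanJacobian (hr : 0 < r) (hUm : ∀ β, Measurable fun z => U z β)
    (hU : ∀ z, ContDiffOn ℝ 1 (U z) (Metric.ball β₀ r))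
    (hM : ∀ β ∈ Metric.ball β₀ r, ∀ z, ‖fderiv ℝ (U z) β‖ ≤ M z)
    (hset : ∀ s, MeasurableSet s → Tendsto (fun i => μs i s) l (𝓝 (μ s)))
    (hMfin : ∫⁻ z, ENNReal.ofReal (M z) ∂μ < ∞)
    (hMlim : Tendsto (fun i => ∫⁻ z, ENNReal.ofReal (M z) ∂(μs i)) l
      (𝓝 (∫⁻ z, ENNReal.ofReal (M z) ∂μ))) :
    Tendsto (fun i => meanJacobian U (μs i) β₀) l (𝓝 (meanJacobian U μ β₀)) := by
  refine tendsto_pi_nhds.2 fun a => tendsto_pi_nhds.2 fun b => ?_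
  refine tendsto_integral_of_tendsto_measure hset
    ((EuclideanSpace.proj (𝕜 := ℝ) a).continuous.measurable.comp
      (measurable_fderiv_apply hr hUm hU _)) (fun z => ?_) hMfin.ne hMlim
  calc |fderiv ℝ (U z) β₀ (EuclideanSpace.single b 1) a|
      ≤ ‖fderiv ℝ (U z) β₀ (EuclideanSpace.single b 1)‖ := by
        rw [← Real.norm_eq_abs]; exact PiLp.norm_apply_le _ _
    _ ≤ ‖fderiv ℝ (U z) β₀‖ * ‖EuclideanSpace.single b (1 : ℝ)‖ :=
        ContinuousLinearMap.le_opNorm _ _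
    _ ≤ M z := by simpa using hM β₀ (Metric.mem_ball_self hr) z

/-- For each `z`, a continuously differentiable `U z` is strictly differentiable at `β₀`, so the
quotient tends to zero when both points move. The mean value inequality bounds it by `2 M`. Where `x
n = y n` the quotient is `0 / 0 = 0`. -/
theorem tendsto_lintegral_linearization_error (hr : 0 < r)
    (hUm : ∀ β, Measurable fun z => U z β)
    (hU : ∀ z, ContDiffOn ℝ 1 (U z) (Metric.ball β₀ r))
    (hM : ∀ β ∈ Metric.ball β₀ r, ∀ z, ‖fderiv ℝ (U z) β‖ ≤ M z) {μs : ℕ → Measure Z}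
    (hset : ∀ s, MeasurableSet s → Tendsto (fun i => μs i s) atTop (𝓝 (μ s)))
    (hMfin : ∫⁻ z, ENNReal.ofReal (M z) ∂μ < ∞)
    (hMlim : Tendsto (fun i => ∫⁻ z, ENNReal.ofReal (M z) ∂(μs i)) atTop
      (𝓝 (∫⁻ z, ENNReal.ofReal (M z) ∂μ))) {x y : ℕ → EuclideanSpace ℝ (Fin d)}
    (hx : Tendsto x atTop (𝓝 β₀)) (hy : Tendsto y atTop (𝓝 β₀)) :
    Tendsto (fun n => ∫⁻ z, ENNReal.ofReal
      (‖U z (x n) - U z (y n) - fderiv ℝ (U z) β₀ (x n - y n)‖ / ‖x n - y n‖) ∂(μs n))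
      atTop (𝓝 0) := by
  have hM0 : ∀ z, 0 ≤ M z := fun z => (norm_nonneg _).trans (hM β₀ (Metric.mem_ball_self hr) z)
  have h2M : ∀ ν : Measure Z, ∫⁻ z, ENNReal.ofReal (2 * M z) ∂ν
      = 2 * ∫⁻ z, ENNReal.ofReal (M z) ∂ν := fun ν => by
    rw [← lintegral_const_mul' _ _ (by simp)]
    simp_rw [ENNReal.ofReal_mul zero_le_two]
    simp
  refine tendsto_lintegral_zero_of_tendsto_measure hset
    (G := fun z => ENNReal.ofReal (2 * M z)) (fun n => ?_) ?_ (fun z => ?_) ?_ ?_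
  · exact ((((hUm _).sub (hUm _)).sub (measurable_fderiv_apply hr hUm hU _)).norm.div_const
      _).ennreal_ofReal
  · filter_upwards [hx.eventually (Metric.ball_mem_nhds β₀ hr),
      hy.eventually (Metric.ball_mem_nhds β₀ hr)] with n hxn hyn z
    refine ENNReal.ofReal_le_ofReal (div_le_of_le_mul₀ (norm_nonneg _)
      (mul_nonneg zero_le_two (hM0 z)) ?_)
    calc _ ≤ ‖U z (x n) - U z (y n)‖ + ‖fderiv ℝ (U z) β₀ (x n - y n)‖ := norm_sub_le _ _
      _ ≤ M z * ‖x n - y n‖ + M z * ‖x n - y n‖ :=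
        add_le_add (norm_sub_le_of_fderiv_le hU hM hxn hyn z)
          ((ContinuousLinearMap.le_opNorm _ _).trans
            (mul_le_mul_of_nonneg_right (hM β₀ (Metric.mem_ball_self hr) z) (norm_nonneg _)))
      _ = 2 * M z * ‖x n - y n‖ := by ring
  · have hd : HasStrictFDerivAt (U z) (fderiv ℝ (U z) β₀) β₀ :=
      ((hU z).contDiffAt (Metric.ball_mem_nhds β₀ hr)).hasStrictFDerivAt one_ne_zero
    have h1 := hd.isLittleO.comp_tendsto (hx.prodMk_nhds hy)
    have h2 := h1.norm_norm.tendsto_div_nhds_zero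
    simpa using ENNReal.tendsto_ofReal h2
  · rw [h2M]; exact ENNReal.mul_ne_top (by simp) hMfin.ne
  · simp_rw [h2M]
    exact ENNReal.Tendsto.const_mul hMlim (Or.inr (by simp))

theorem norm_integral_sub_sub_le (hr : 0 < r) (hUm : ∀ β, Measurable fun z => U z β)
    (hU : ∀ z, ContDiffOn ℝ 1 (U z) (Metric.ball β₀ r)) (hMm : Measurable M)
    (hM : ∀ β ∈ Metric.ball β₀ r, ∀ z, ‖fderiv ℝ (U z) β‖ ≤ M z)
    (hMfin : ∫⁻ z, ENNReal.ofReal (M z) ∂μ < ∞) (hU0 : Integrable (fun z => U z β₀) μ)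
    {x y : EuclideanSpace ℝ (Fin d)} (hx : x ∈ Metric.ball β₀ r) (hy : y ∈ Metric.ball β₀ r)
    {e e' : ℝ} (he : 0 ≤ e) (A : EuclideanSpace ℝ (Fin d) →L[ℝ] EuclideanSpace ℝ (Fin d))
    (herr : ∫⁻ z, ENNReal.ofReal
      (‖U z x - U z y - fderiv ℝ (U z) β₀ (x - y)‖ / ‖x - y‖) ∂μ ≤ ENNReal.ofReal e)
    (hA : ‖Matrix.toEuclideanCLM (𝕜 := ℝ) (meanJacobian U μ β₀) - A‖ ≤ e') :
    ‖∫ z, U z x ∂μ - ∫ z, U z y ∂μ - A (x - y)‖ ≤ (e + e') * ‖x - y‖ := by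
  have hix := integrable_of_fderiv_le hr hUm hU hMm hM hMfin hU0 hx
  have hiy := integrable_of_fderiv_le hr hUm hU hMm hM hMfin hU0 hy
  have hid := integrable_fderiv_apply hr hUm hU hMm hM hMfin (x - y)
  -- The two errors are the averaged linearization error and the gap between the mean Jacobian under
  -- `μ` and the target `A`.
  have hsplit : ∫ z, U z x ∂μ - ∫ z, U z y ∂μ - A (x - y)
      = ∫ z, (U z x - U z y - fderiv ℝ (U z) β₀ (x - y)) ∂μ
        + (Matrix.toEuclideanCLM (𝕜 := ℝ) (meanJacobian U μ β₀) - A) (x - y) := by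
    have hixy : Integrable (fun z => U z x - U z y) μ := hix.sub hiy
    rw [integral_sub hixy hid, integral_sub hix hiy,
      integral_fderiv_apply hr hUm hU hMm hM hMfin, _root_.sub_apply]
    abel
  have h1 : ‖∫ z, (U z x - U z y - fderiv ℝ (U z) β₀ (x - y)) ∂μ‖ ≤ e * ‖x - y‖ := by
    rcases eq_or_ne (‖x - y‖) 0 with h0 | h0
    · have hxy : x = y := sub_eq_zero.1 (norm_eq_zero.1 h0)
      simp [hxy]
    refine (norm_integral_le_lintegral_norm _).trans
      (ENNReal.toReal_le_of_le_ofReal (by positivity) ?_)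
    calc ∫⁻ z, ENNReal.ofReal ‖U z x - U z y - fderiv ℝ (U z) β₀ (x - y)‖ ∂μ
        = ∫⁻ z, ENNReal.ofReal (‖U z x - U z y - fderiv ℝ (U z) β₀ (x - y)‖ / ‖x - y‖)
            * ENNReal.ofReal ‖x - y‖ ∂μ := by
          refine lintegral_congr fun z => ?_
          rw [← ENNReal.ofReal_mul (by positivity), div_mul_cancel₀ _ h0]
      _ = _ := lintegral_mul_const' _ _ ENNReal.ofReal_ne_top
      _ ≤ ENNReal.ofReal e * ENNReal.ofReal ‖x - y‖ := by gcongr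
      _ = _ := (ENNReal.ofReal_mul he).symm
  have h2 : ‖(Matrix.toEuclideanCLM (𝕜 := ℝ) (meanJacobian U μ β₀) - A) (x - y)‖
      ≤ e' * ‖x - y‖ :=
    (ContinuousLinearMap.le_opNorm _ _).trans
      (mul_le_mul_of_nonneg_right hA (norm_nonneg _))
  rw [hsplit]
  refine (norm_add_le _ _).trans ?_
  linarith

theorem tendsto_toEuclideanCLM_sub {A : ι → Matrix (Fin d) (Fin d) ℝ}
    {B : Matrix (Fin d) (Fin d) ℝ} (h : Tendsto A l (𝓝 B)) :
    Tendsto (fun i => ‖Matrix.toEuclideanCLM (𝕜 := ℝ) (A i)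
      - Matrix.toEuclideanCLM (𝕜 := ℝ) B‖) l (𝓝 0) := by
  have hc : Continuous fun A : Matrix (Fin d) (Fin d) ℝ => Matrix.toEuclideanCLM (𝕜 := ℝ) A :=
    LinearMap.continuous_of_finiteDimensional
      (Matrix.toEuclideanCLM (n := Fin d) (𝕜 := ℝ)).toAlgEquiv.toLinearMap
  exact tendsto_iff_norm_sub_tendsto_zero.1 ((hc.tendsto B).comp h)

theorem exists_ball_eventually_of_eventually_prod {X ι : Type*} [PseudoMetricSpace X]
    {l : Filter ι} {x₀ : X} {p : ι → X → X → Prop}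
    (h : ∀ᶠ q in l ×ˢ (𝓝 x₀ ×ˢ 𝓝 x₀), p q.1 q.2.1 q.2.2) :
    ∃ δ > 0, ∀ᶠ i in l, ∀ x ∈ Metric.ball x₀ δ, ∀ y ∈ Metric.ball x₀ δ, p i x y := by
  obtain ⟨pa, hpa, pb, hpb, h⟩ := eventually_prod_iff.1 h
  obtain ⟨pc, hpc, pd, hpd, h'⟩ := eventually_prod_iff.1 hpb
  obtain ⟨δ, hδ, hδs⟩ := Metric.eventually_nhds_iff_ball.1 (hpc.and hpd)
  exact ⟨δ, hδ, hpa.mono fun i hi x hx y hy => h hi (h' (hδs x hx).1 (hδs y hy).2)⟩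

/-- Uniformity in `i`, `x` and `y` is proved along arbitrary sequences of triples, since the
dominated convergence used here is sequential; this is why `l` must be countably generated. -/
theorem eventually_norm_integral_sub_le [l.IsCountablyGenerated] (hr : 0 < r)
    (hUm : ∀ β, Measurable fun z => U z β)
    (hU : ∀ z, ContDiffOn ℝ 1 (U z) (Metric.ball β₀ r)) (hMm : Measurable M)
    (hM : ∀ β ∈ Metric.ball β₀ r, ∀ z, ‖fderiv ℝ (U z) β‖ ≤ M z)
    (hset : ∀ s, MeasurableSet s → Tendsto (fun i => μs i s) l (𝓝 (μ s)))
    (hMfin : ∫⁻ z, ENNReal.ofReal (M z) ∂μ < ∞)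
    (hMlim : Tendsto (fun i => ∫⁻ z, ENNReal.ofReal (M z) ∂(μs i)) l
      (𝓝 (∫⁻ z, ENNReal.ofReal (M z) ∂μ)))
    (hU0 : ∀ᶠ i in l, Integrable (fun z => U z β₀) (μs i)) {ε : ℝ} (hε : 0 < ε) :
    ∃ δ > 0, ∀ᶠ i in l, ∀ x ∈ Metric.ball β₀ δ, ∀ y ∈ Metric.ball β₀ δ,
      ‖∫ z, U z x ∂(μs i) - ∫ z, U z y ∂(μs i)
        - Matrix.toEuclideanCLM (𝕜 := ℝ) (meanJacobian U μ β₀) (x - y)‖ ≤ ε * ‖x - y‖ := by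
  refine exists_ball_eventually_of_eventually_prod ?_
  rw [eventually_iff_seq_eventually]
  intro p hp
  have hp1 : Tendsto (fun n => (p n).1) atTop l := tendsto_fst.comp hp
  have hp2 := tendsto_snd.comp hp
  have hx : Tendsto (fun n => (p n).2.1) atTop (𝓝 β₀) := tendsto_fst.comp hp2
  have hy : Tendsto (fun n => (p n).2.2) atTop (𝓝 β₀) := tendsto_snd.comp hp2
  have herr := tendsto_lintegral_linearization_error hr hUm hU hM
    (fun s hs => (hset s hs).comp hp1) hMfin (hMlim.comp hp1) hx hy
  have hjac := tendsto_toEuclideanCLM_sub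
    ((tendsto_meanJacobian hr hUm hU hM hset hMfin hMlim).comp hp1)
  have e1 := hx.eventually (Metric.ball_mem_nhds β₀ hr)
  have e2 := hy.eventually (Metric.ball_mem_nhds β₀ hr)
  have e3 := hp1.eventually hU0
  have e4 : ∀ᶠ n in atTop, ∫⁻ z, ENNReal.ofReal (M z) ∂(μs (p n).1) < ∞ :=
    hp1.eventually (hMlim.eventually (gt_mem_nhds hMfin))
  have e5 : ∀ᶠ n in atTop, ‖Matrix.toEuclideanCLM (𝕜 := ℝ) (meanJacobian U (μs (p n).1) β₀)
      - Matrix.toEuclideanCLM (𝕜 := ℝ) (meanJacobian U μ β₀)‖ ≤ ε / 2 :=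
    hjac.eventually (ge_mem_nhds (half_pos hε))
  have e6 := herr.eventually (ge_mem_nhds (ENNReal.ofReal_pos.2 (half_pos hε)))
  filter_upwards [e1, e2, e3, e4, e5, e6] with n hxn hyn hUn hMn hjn hen
  have := norm_integral_sub_sub_le hr hUm hU hMm hM hMn hUn hxn hyn (half_pos hε).le _ hen hjn
  rwa [add_halves] at this

end EstimatingFunction

/-- The linear equivalence of Euclidean space given by a nonsingular matrix. -/
noncomputable def euclideanEquivOfDet {d : ℕ} (A : Matrix (Fin d) (Fin d) ℝ) (hA : IsUnit A.det) :
    EuclideanSpace ℝ (Fin d) ≃L[ℝ] EuclideanSpace ℝ (Fin d) :=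
  ContinuousLinearEquiv.equivOfInverse (Matrix.toEuclideanCLM (𝕜 := ℝ) A)
    (Matrix.toEuclideanCLM (𝕜 := ℝ) A⁻¹)
    (fun v => by
      rw [← mul_apply_eq_comp, ← map_mul, Matrix.nonsing_inv_mul A hA, map_one]; rfl)
    (fun v => by
      rw [← mul_apply_eq_comp, ← map_mul, Matrix.mul_nonsing_inv A hA, map_one]; rfl)

theorem eventually_nhdsGE_of_nhdsGT {p : ℝ → Prop} {a : ℝ} (h : ∀ᶠ t in 𝓝[>] a, p t) (h0 : p a) :
    ∀ᶠ t in 𝓝[≥] a, p t := by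
  rw [← Ioi_insert, nhdsWithin_insert, eventually_sup]
  exact ⟨h0, h⟩

theorem tendsto_nhdsGE_of_nhdsGT {X : Type*} [TopologicalSpace X] {f : ℝ → X} {a : ℝ}
    (h : Tendsto f (𝓝[>] a) (𝓝 (f a))) : Tendsto f (𝓝[≥] a) (𝓝 (f a)) := by
  rw [← Ioi_insert, nhdsWithin_insert]
  exact tendsto_sup.2 ⟨tendsto_pure_nhds f a, h⟩

theorem HasScore.tendsto_integral {Z : Type*} [MeasurableSpace Z] {Q₀ : Measure Z}
    [IsFiniteMeasure Q₀] {Q : ℝ → Measure Z} [∀ t, IsFiniteMeasure (Q t)] {f g : Z → ℝ}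
    (hs : HasScore Q₀ Q g) (hfm : Measurable f) (hgm : Measurable g) (hf0 : MemLp f 2 Q₀)
    (hg : MemLp g 2 Q₀) {C : ℝ≥0} (hft : ∀ᶠ t in 𝓝[>] 0, ∫⁻ z, ‖f z‖ₑ ^ 2 ∂(Q t) ≤ C) :
    Tendsto (fun t => ∫ z, f z ∂(Q t)) (𝓝[>] 0) (𝓝 (∫ z, f z ∂Q₀)) := by
  have h := (hs.tendsto_slope_integral hfm hgm hf0 hg hft).2
  have ht0 : Tendsto (fun t : ℝ => t) (𝓝[>] 0) (𝓝 0) :=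
    tendsto_nhdsWithin_of_tendsto_nhds tendsto_id
  have h1 := (ht0.mul h).add_const (∫ z, f z ∂Q₀)
  rw [zero_mul, zero_add] at h1
  refine h1.congr' ?_
  filter_upwards [self_mem_nhdsWithin] with t ht
  rw [mul_div_cancel₀ _ (ne_of_gt ht)]
  ring

/-! ### Regular paths: the parameter curve and its derivative -/

section Model

variable {K d : ℕ} {𝒳 : Type*} [MeasurableSpace 𝒳] {P : Matrix (Fin K) (Fin K) ℝ}
  {U : Fin K → 𝒳 → EuclideanSpace ℝ (Fin d) → EuclideanSpace ℝ (Fin d)}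
  {μ₀ : Measure (Fin K × 𝒳)} {β₀ : EuclideanSpace ℝ (Fin d)} {μ : ℝ → Measure (Fin K × 𝒳)}

omit [MeasurableSpace 𝒳] in
theorem phi_apply (P : Matrix (Fin K) (Fin K) ℝ)
    (U : Fin K → 𝒳 → EuclideanSpace ℝ (Fin d) → EuclideanSpace ℝ (Fin d))
    (β : EuclideanSpace ℝ (Fin d)) (z : Fin K × 𝒳) (a : Fin d) :
    phi P U β z a = invMean P (fun w => U w.1 w.2 β a) z := by
  simp [phi, invMean, Matrix.mul_apply, UMatrix]

theorem measurable_uncurry_estimating (hUmeas : ∀ k β, Measurable fun x => U k x β)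
    (β : EuclideanSpace ℝ (Fin d)) : Measurable fun z : Fin K × 𝒳 => U z.1 z.2 β :=
  measurable_from_prod_countable_right fun k => hUmeas k β

theorem measurable_uncurry_estimating_apply (hUmeas : ∀ k β, Measurable fun x => U k x β)
    (β : EuclideanSpace ℝ (Fin d)) (a : Fin d) :
    Measurable fun z : Fin K × 𝒳 => U z.1 z.2 β a :=
  (EuclideanSpace.proj (𝕜 := ℝ) a).continuous.measurable.comp
    (measurable_uncurry_estimating hUmeas β)

theorem measurable_phi_apply (hUmeas : ∀ k β, Measurable fun x => U k x β)
    (β : EuclideanSpace ℝ (Fin d)) (a : Fin d) : Measurable fun z => phi P U β z a := by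
  simp_rw [phi_apply]
  exact measurable_invMean P (measurable_uncurry_estimating_apply hUmeas β a)

theorem memLp_phi_apply (hφ : MemLp (phi P U β₀) 2 (obsLaw P μ₀)) (a : Fin d) :
    MemLp (fun z => phi P U β₀ z a) 2 (obsLaw P μ₀) :=
  (EuclideanSpace.proj (𝕜 := ℝ) a).comp_memLp' hφ

/-- Integrability of all `φ (Y*, X; β)` coordinates gives that of `U (Y, X; β)`. -/
theorem integral_estimating_eq (hP : IsTransitionMatrix P) (hPdet : IsUnit P.det)
    (hUmeas : ∀ k β, Measurable fun x => U k x β) {ν : Measure (Fin K × 𝒳)}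
    {β : EuclideanSpace ℝ (Fin d)}
    (h : ∀ a, Integrable (fun z => phi P U β z a) (obsLaw P ν)) :
    Integrable (fun z => U z.1 z.2 β) ν ∧
      ∀ a, (∫ z, U z.1 z.2 β ∂ν) a = ∫ z, phi P U β z a ∂(obsLaw P ν) := by
  simp_rw [phi_apply] at h ⊢
  have h1 := fun a => integrable_of_invMean hP hPdet
    (measurable_uncurry_estimating_apply hUmeas β a) (h a)
  have hi : Integrable (fun z => U z.1 z.2 β) ν := by
    have hn : Integrable (fun z => ∑ a, |U z.1 z.2 β a|) ν :=
      integrable_finsetSum _ fun a _ => (h1 a).1.abs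
    refine hn.mono' (measurable_uncurry_estimating hUmeas β).aestronglyMeasurable
      (.of_forall fun z => ?_)
    have hs : U z.1 z.2 β = ∑ a, EuclideanSpace.single a (U z.1 z.2 β a) := by
      ext i; simp [Pi.single_apply]
    conv_lhs => rw [hs]
    refine (norm_sum_le _ _).trans (Finset.sum_le_sum fun a _ => ?_)
    simp
  refine ⟨hi, fun a => ?_⟩
  rw [← (h1 a).2]
  exact ((EuclideanSpace.proj (𝕜 := ℝ) a).integral_comp_comm hi).symm

variable {g : Fin K × 𝒳 → ℝ}

/-- An indicator of `(Y, X)` is represented by a function of `(Y*, X)` bounded by the sum of the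
`|P⁻¹ k j|`. Its second moments are bounded along any path, so differentiability of the observed
path alone controls the hidden laws. -/
theorem tendsto_measure_of_hasScore (hP : IsTransitionMatrix P) (hPdet : IsUnit P.det)
    [∀ t, IsProbabilityMeasure (μ t)] (hgm : Measurable g) (hg : MemLp g 2 (obsLaw P (μ 0)))
    (hs : HasScore (obsLaw P (μ 0)) (fun t => obsLaw P (μ t)) g) {s : Set (Fin K × 𝒳)}
    (hsm : MeasurableSet s) : Tendsto (fun t => μ t s) (𝓝[≥] 0) (𝓝 (μ 0 s)) := by
  have := fun t => isProbabilityMeasure_obsLaw hP (μ t)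
  set u : Fin K × 𝒳 → ℝ := s.indicator 1 with hu
  have hum : Measurable u := measurable_one.indicator hsm
  set f := invMean P u with hf
  have hfm : Measurable f := measurable_invMean P hum
  set B : ℝ≥0 := ∑ k, ∑ j, ‖P⁻¹ k j‖₊ with hB
  have hfB : ∀ z, ‖f z‖ ≤ B := fun z => by
    rw [hB]; push_cast
    refine (norm_sum_le _ _).trans (Finset.sum_le_sum fun k _ => ?_)
    calc ‖u (k, z.2) * P⁻¹ k z.1‖ ≤ 1 * ‖P⁻¹ k z.1‖ := by
          rw [norm_mul]
          gcongr
          exact (norm_indicator_le_norm_self _ _).trans (by simp)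
      _ ≤ ∑ j, ‖P⁻¹ k j‖ := by
          rw [one_mul]
          exact Finset.single_le_sum (f := fun j => ‖P⁻¹ k j‖) (fun j _ => norm_nonneg _)
            (Finset.mem_univ z.1)
  have hmem : ∀ ν : Measure (Fin K × 𝒳), IsFiniteMeasure ν → MemLp f 2 ν := fun ν _ =>
    MemLp.of_bound hfm.aestronglyMeasurable B (.of_forall hfB)
  have hbound : ∀ t, ∫⁻ z, ‖f z‖ₑ ^ 2 ∂(obsLaw P (μ t)) ≤ ((B ^ 2 : ℝ≥0) : ℝ≥0∞) := fun t => by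
    calc ∫⁻ z, ‖f z‖ₑ ^ 2 ∂(obsLaw P (μ t)) ≤ ∫⁻ _, (B : ℝ≥0∞) ^ 2 ∂(obsLaw P (μ t)) := by
          refine lintegral_mono fun z => ?_
          gcongr
          exact enorm_le_coe.2 (hfB z)
      _ = _ := by simp
  have h := hs.tendsto_integral hfm hgm (hmem _ inferInstance) hg (.of_forall hbound)
  have hI : ∀ t, ∫ z, f z ∂(obsLaw P (μ t)) = (μ t).real s := fun t => by
    rw [hf, ← (integrable_of_invMean hP hPdet hum
      ((hmem (obsLaw P (μ t)) inferInstance).integrable one_le_two)).2, hu,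
      integral_indicator_one hsm]
  simp_rw [hI] at h
  refine tendsto_nhdsGE_of_nhdsGT ?_
  simpa [Measure.real] using ENNReal.tendsto_ofReal h

/-- The mean of `U(β₀)` under `μ_t` is the mean of `φ(β₀)` under the observed law; it vanishes at `t
= 0`, and the score differentiates it. -/
theorem IsRegularPath.tendsto_integral_estimating (hμ : IsRegularPath P U μ₀ β₀ μ)
    (hP : IsTransitionMatrix P) (hPdet : IsUnit P.det)
    (hUmeas : ∀ k β, Measurable fun x => U k x β) (hφ : MemLp (phi P U β₀) 2 (obsLaw P μ₀))
    (hβ₀ : SolvesEstimatingEq U μ₀ β₀) (hgm : Measurable g) (hg : MemLp g 2 (obsLaw P μ₀))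
    (hs : HasScore (obsLaw P μ₀) (fun t => obsLaw P (μ t)) g) :
    (∀ᶠ t in 𝓝[≥] 0, Integrable (fun z => U z.1 z.2 β₀) (μ t)) ∧
    Tendsto (fun t : ℝ => t⁻¹ • ∫ z, U z.1 z.2 β₀ ∂(μ t)) (𝓝[>] 0)
      (𝓝 (WithLp.toLp 2 fun a => ∫ z, phi P U β₀ z a * g z ∂(obsLaw P μ₀))) := by
  obtain ⟨hprob, h0, ⟨C, hC⟩, -⟩ := hμ
  have := fun t => isProbabilityMeasure_obsLaw hP (μ t)
  have : IsProbabilityMeasure μ₀ := h0 ▸ hprob 0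
  have := isProbabilityMeasure_obsLaw hP μ₀
  have hCa : ∀ a, ∀ᶠ t in 𝓝[>] 0, ∫⁻ z, ‖phi P U β₀ z a‖ₑ ^ 2 ∂(obsLaw P (μ t)) ≤ C := fun a => by
    filter_upwards [nhdsWithin_mono _ Ioi_subset_Ici_self hC] with t ht
    refine (lintegral_mono fun z => ?_).trans ht
    gcongr
    exact enorm_le_iff_norm_le.2 (PiLp.norm_apply_le _ _)
  have hsl := fun a => hs.tendsto_slope_integral (measurable_phi_apply hUmeas β₀ a) hgm
    (memLp_phi_apply hφ a) hg (hCa a)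
  have hint : ∀ᶠ t in 𝓝[>] 0, ∀ a, Integrable (fun z => phi P U β₀ z a) (obsLaw P (μ t)) :=
    eventually_all.2 fun a => (hsl a).1.mono fun t ht => ht.integrable one_le_two
  have hzero : ∀ a, ∫ z, phi P U β₀ z a ∂(obsLaw P μ₀) = 0 := fun a => by
    rw [← (integral_estimating_eq hP hPdet hUmeas
      (fun a => (memLp_phi_apply hφ a).integrable one_le_two)).2 a, hβ₀.2]
    rfl
  constructor
  · refine eventually_nhdsGE_of_nhdsGT ?_ (h0 ▸ hβ₀.1)
    exact hint.mono fun t ht => (integral_estimating_eq hP hPdet hUmeas ht).1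
  · have h1 : Tendsto (fun t : ℝ => fun a => (∫ z, phi P U β₀ z a ∂(obsLaw P (μ t))
        - ∫ z, phi P U β₀ z a ∂(obsLaw P μ₀)) / t) (𝓝[>] 0)
        (𝓝 fun a => ∫ z, phi P U β₀ z a * g z ∂(obsLaw P μ₀)) :=
      tendsto_pi_nhds.2 fun a => (hsl a).2
    refine (((PiLp.continuous_toLp 2 _).tendsto _).comp h1).congr' ?_
    filter_upwards [hint] with t ht
    ext a
    simp only [Function.comp_apply, PiLp.smul_apply, smul_eq_mul, hzero, sub_zero]
    rw [(integral_estimating_eq hP hPdet hUmeas ht).2 a, div_eq_inv_mul]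

theorem exists_ball_jacobianEnvelope
    (hUdiff : ∃ N, IsOpen N ∧ β₀ ∈ N ∧ ∀ k x, ContDiffOn ℝ 1 (U k x) N) {M : Fin K × 𝒳 → ℝ}
    (hM : IsJacobianEnvelope U β₀ M) :
    ∃ r > 0, (∀ z : Fin K × 𝒳, ContDiffOn ℝ 1 (U z.1 z.2) (Metric.ball β₀ r)) ∧
      ∀ β ∈ Metric.ball β₀ r, ∀ z : Fin K × 𝒳, ‖fderiv ℝ (U z.1 z.2) β‖ ≤ M z := by
  obtain ⟨N, hNo, hβN, hN⟩ := hUdiff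
  obtain ⟨-, N', hN', hb⟩ := hM
  obtain ⟨r, hr, hsub⟩ := Metric.mem_nhds_iff.1 (inter_mem (hNo.mem_nhds hβN) hN')
  exact ⟨r, hr, fun z => (hN z.1 z.2).mono fun x hx => (hsub hx).1,
    fun β hβ z => hb β (hsub hβ).2 z⟩

theorem IsRegularPath.estimating_approx (hμ : IsRegularPath P U μ₀ β₀ μ)
    (hP : IsTransitionMatrix P) (hPdet : IsUnit P.det)
    (hUmeas : ∀ k β, Measurable fun x => U k x β)
    (hUdiff : ∃ N, IsOpen N ∧ β₀ ∈ N ∧ ∀ k x, ContDiffOn ℝ 1 (U k x) N)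
    (hφ : MemLp (phi P U β₀) 2 (obsLaw P μ₀)) (hβ₀ : SolvesEstimatingEq U μ₀ β₀)
    (hgm : Measurable g) (hg : MemLp g 2 (obsLaw P μ₀))
    (hs : HasScore (obsLaw P μ₀) (fun t => obsLaw P (μ t)) g) :
    (∃ r > 0, ∀ᶠ t in 𝓝[≥] 0, ∀ β ∈ Metric.ball β₀ r,
      Integrable (fun z => U z.1 z.2 β) (μ t)) ∧
    ∀ ε > 0, ∃ δ > 0, ∀ᶠ t in 𝓝[≥] 0, ∀ x ∈ Metric.ball β₀ δ, ∀ y ∈ Metric.ball β₀ δ,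
      ‖∫ z, U z.1 z.2 x ∂(μ t) - ∫ z, U z.1 z.2 y ∂(μ t)
        - Matrix.toEuclideanCLM (𝕜 := ℝ) (Omega U μ₀ β₀) (x - y)‖ ≤ ε * ‖x - y‖ := by
  have hint := (hμ.tendsto_integral_estimating hP hPdet hUmeas hφ hβ₀ hgm hg hs).1
  obtain ⟨hprob, rfl, -, M, hM, hMi, hMlim⟩ := hμ
  obtain ⟨r, hr, hU, hb⟩ := exists_ball_jacobianEnvelope hUdiff hM
  have hUm := measurable_uncurry_estimating hUmeas
  have hMfin : ∫⁻ z, ENNReal.ofReal (M z) ∂(μ 0) < ∞ := hMi.lintegral_lt_top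
  set V : Fin K × 𝒳 → EuclideanSpace ℝ (Fin d) → EuclideanSpace ℝ (Fin d) :=
    fun z => U z.1 z.2
  have hVb : ∀ β ∈ Metric.ball β₀ r, ∀ z, ‖fderiv ℝ (V z) β‖ ≤ M z := hb
  have hfin : ∀ᶠ t in 𝓝[≥] 0, ∫⁻ z, ENNReal.ofReal (M z) ∂(μ t) < ∞ :=
    hMlim.eventually (gt_mem_nhds hMfin)
  constructor
  · refine ⟨r, hr, ?_⟩
    filter_upwards [hint, hfin] with t h1 h2 β hβ
    exact integrable_of_fderiv_le (U := V) (M := M) hr hUm hU hM.1 hVb h2 h1 hβ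
  · intro ε hε
    have h := eventually_norm_integral_sub_le (U := V) (M := M) hr hUm hU hM.1 hVb
      (fun s hsm => tendsto_measure_of_hasScore hP hPdet hgm hg hs hsm) hMfin hMlim hint hε
    exact h

theorem IsRegularPath.exists_unique_parameterCurve (hμ : IsRegularPath P U μ₀ β₀ μ)
    (hP : IsTransitionMatrix P) (hPdet : IsUnit P.det)
    (hUmeas : ∀ k β, Measurable fun x => U k x β)
    (hUdiff : ∃ N, IsOpen N ∧ β₀ ∈ N ∧ ∀ k x, ContDiffOn ℝ 1 (U k x) N)
    (hφ : MemLp (phi P U β₀) 2 (obsLaw P μ₀)) (hβ₀ : SolvesEstimatingEq U μ₀ β₀)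
    (hΩ : IsUnit (Omega U μ₀ β₀).det) (hgm : Measurable g) (hg : MemLp g 2 (obsLaw P μ₀))
    (hs : HasScore (obsLaw P μ₀) (fun t => obsLaw P (μ t)) g) :
    (∃ b, IsParameterCurve U β₀ μ b) ∧
      ∀ b b', IsParameterCurve U β₀ μ b → IsParameterCurve U β₀ μ b' → b =ᶠ[𝓝[≥] 0] b' := by
  obtain ⟨⟨r, hr, hint⟩, happ⟩ := hμ.estimating_approx hP hPdet hUmeas hUdiff hφ hβ₀ hgm hg hs
  have hslope := (hμ.tendsto_integral_estimating hP hPdet hUmeas hφ hβ₀ hgm hg hs).2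
  have h0 : μ 0 = μ₀ := hμ.2.1
  have hF0 : ∫ z, U z.1 z.2 β₀ ∂(μ 0) = 0 := by rw [h0, hβ₀.2]
  have hlim : Tendsto (fun t => ∫ z, U z.1 z.2 β₀ ∂(μ t)) (𝓝[≥] 0) (𝓝 0) := by
    rw [← hF0]
    refine tendsto_nhdsGE_of_nhdsGT ?_
    rw [hF0]
    have ht0 : Tendsto (fun t : ℝ => t) (𝓝[>] 0) (𝓝 0) :=
      tendsto_nhdsWithin_of_tendsto_nhds tendsto_id
    have h1 := ht0.smul hslope
    rw [zero_smul] at h1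
    refine h1.congr' ?_
    filter_upwards [self_mem_nhdsWithin] with t ht
    rw [smul_smul, mul_inv_cancel₀ (ne_of_gt ht), one_smul]
  obtain ⟨δ, hδ, hsub, C, hC⟩ := eventually_injOn_and_exists_zero
    (F := fun t β => ∫ z, U z.1 z.2 β ∂(μ t)) (L := euclideanEquivOfDet _ hΩ) happ hlim
    (Metric.ball_mem_nhds β₀ hr)
  constructor
  · classical
    -- The default `β₀` is taken only where no suitable zero exists, which does not happen for small
    -- `t`. The bound on `‖x - β₀‖` is part of the choice because it yields continuity at `0`.
    set b : ℝ → EuclideanSpace ℝ (Fin d) := fun t =>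
      if h : ∃ x ∈ Metric.ball β₀ δ, ‖x - β₀‖ ≤ C * ‖∫ z, U z.1 z.2 β₀ ∂(μ t)‖ ∧
        ∫ z, U z.1 z.2 x ∂(μ t) = 0 then h.choose else β₀ with hb
    have hbt : ∀ᶠ t in 𝓝[≥] 0, b t ∈ Metric.ball β₀ δ ∧
        ‖b t - β₀‖ ≤ C * ‖∫ z, U z.1 z.2 β₀ ∂(μ t)‖ ∧ ∫ z, U z.1 z.2 (b t) ∂(μ t) = 0 := by
      filter_upwards [hC] with t ht
      rw [hb]
      simp only [dif_pos ht.2]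
      exact ht.2.choose_spec
    have hb0 : b 0 = β₀ := by
      -- The filter `𝓝[≥] 0` contains the point `0` itself, where the bound reads `‖b 0 - β₀‖ ≤ 0`.
      have h1 := (mem_of_mem_nhdsWithin (self_mem_Ici) hbt).2.1
      rw [hF0, norm_zero, mul_zero] at h1
      exact sub_eq_zero.1 (norm_le_zero_iff.1 h1)
    refine ⟨b, hb0, ?_, ?_⟩
    · rw [ContinuousWithinAt, hb0, tendsto_iff_norm_sub_tendsto_zero]
      have h2 := hlim.norm.const_mul C
      rw [norm_zero, mul_zero] at h2
      exact squeeze_zero' (.of_forall fun t => norm_nonneg _) (hbt.mono fun t ht => ht.2.1) h2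
    · filter_upwards [hbt, hint] with t h1 h2
      exact ⟨h2 _ (hsub h1.1), h1.2.2⟩
  · rintro b b' ⟨hb0, hbc, hbs⟩ ⟨hb0', hbc', hbs'⟩
    -- Uniqueness: continuity brings both curves into the ball on which the mean estimating function
    -- is injective.
    have e1 : ∀ᶠ t in 𝓝[≥] 0, b t ∈ Metric.ball β₀ δ :=
      hbc.eventually (hb0 ▸ Metric.ball_mem_nhds _ hδ)
    have e2 : ∀ᶠ t in 𝓝[≥] 0, b' t ∈ Metric.ball β₀ δ :=
      hbc'.eventually (hb0' ▸ Metric.ball_mem_nhds _ hδ)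
    filter_upwards [e1, e2, hbs, hbs', hC] with t h1 h2 h3 h4 h5
    exact h5.1 h1 h2 (h3.2.trans h4.2.symm)

theorem IsRegularPath.hasDerivWithinAt_parameterCurve (hμ : IsRegularPath P U μ₀ β₀ μ)
    (hP : IsTransitionMatrix P) (hPdet : IsUnit P.det)
    (hUmeas : ∀ k β, Measurable fun x => U k x β)
    (hUdiff : ∃ N, IsOpen N ∧ β₀ ∈ N ∧ ∀ k x, ContDiffOn ℝ 1 (U k x) N)
    (hφ : MemLp (phi P U β₀) 2 (obsLaw P μ₀)) (hβ₀ : SolvesEstimatingEq U μ₀ β₀)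
    (hΩ : IsUnit (Omega U μ₀ β₀).det) (hgm : Measurable g) (hg : MemLp g 2 (obsLaw P μ₀))
    (hs : HasScore (obsLaw P μ₀) (fun t => obsLaw P (μ t)) g)
    {b : ℝ → EuclideanSpace ℝ (Fin d)} (hb : IsParameterCurve U β₀ μ b) :
    HasDerivWithinAt b (-Matrix.toEuclideanCLM (𝕜 := ℝ) (Omega U μ₀ β₀)⁻¹
      (WithLp.toLp 2 fun a => ∫ z, phi P U β₀ z a * g z ∂(obsLaw P μ₀))) (Ici 0) 0 := by
  obtain ⟨-, happ⟩ := hμ.estimating_approx hP hPdet hUmeas hUdiff hφ hβ₀ hgm hg hs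
  have hslope := (hμ.tendsto_integral_estimating hP hPdet hUmeas hφ hβ₀ hgm hg hs).2
  have hle : 𝓝[>] (0 : ℝ) ≤ 𝓝[≥] 0 := nhdsWithin_mono _ Ioi_subset_Ici_self
  refine hasDerivWithinAt_zero_of_approx (F := fun t β => ∫ z, U z.1 z.2 β ∂(μ t))
    (L := euclideanEquivOfDet _ hΩ) (fun ε hε => ?_) hslope hb.1 hb.2.1
    ((hb.2.2.filter_mono hle).mono fun t ht => ht.2)
  obtain ⟨δ, hδ, h⟩ := happ ε hε
  exact ⟨δ, hδ, h.filter_mono hle⟩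

end Model

/-! ### Mixture paths and their scores -/

theorem abs_sqrt_one_add_mul_sub_le {t y B : ℝ} (ht : 0 < t) (hy : |y| ≤ B)
    (hty : 0 ≤ 1 + t * y) : |(√(1 + t * y) - 1) / t - 1 / 2 * y| ≤ t * B ^ 2 / 2 := by
  set s := √(1 + t * y) with hs
  have hs0 : 0 ≤ s := Real.sqrt_nonneg _
  have hs2 : s ^ 2 = 1 + t * y := Real.sq_sqrt hty
  -- The error is an exact square because `s² = 1 + t y`; and `|s - 1| ≤ |t y|` because `(s - 1)(s +
  -- 1) = t y` with `s + 1 ≥ 1`.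
  have h1 : (s - 1) / t - 1 / 2 * y = -((s - 1) ^ 2 / (2 * t)) := by
    field_simp
    linear_combination hs2
  have h2 : (s - 1) ^ 2 ≤ (t * B) ^ 2 := by
    have h3 : (s - 1) * (s + 1) = t * y := by linear_combination hs2
    have h4 : (s - 1) ^ 2 ≤ (t * y) ^ 2 := by
      rw [← h3, mul_pow]
      nlinarith [sq_nonneg (s - 1)]
    refine h4.trans (sq_le_sq' ?_ ?_)
    · nlinarith [neg_abs_le y]
    · nlinarith [le_abs_self y]
  rw [h1, abs_neg, abs_of_nonneg (by positivity), div_le_iff₀ (by positivity)]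
  calc _ ≤ _ := h2
    _ = _ := by ring

/-- A path whose densities `1 + t g` with respect to `Q₀` are linear has score `g`. -/
theorem hasScore_of_withDensity {Z : Type*} [MeasurableSpace Z] {Q₀ : Measure Z}
    [IsFiniteMeasure Q₀] {Q : ℝ → Measure Z} [∀ t, IsFiniteMeasure (Q t)] {g : Z → ℝ}
    (hgm : Measurable g) {B : ℝ} (hB : ∀ᵐ z ∂Q₀, |g z| ≤ B)
    (hQ : ∀ᶠ t in 𝓝[>] 0, Q t = Q₀.withDensity fun z => ENNReal.ofReal (1 + t * g z)) :
    HasScore Q₀ Q g := by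
  have hlim : Tendsto (fun t : ℝ => ENNReal.ofReal ((t * B ^ 2 / 2) ^ 2) * Q₀ univ)
      (𝓝[>] 0) (𝓝 0) := by
    have ht0 : Tendsto (fun t : ℝ => t) (𝓝[>] 0) (𝓝 0) :=
      tendsto_nhdsWithin_of_tendsto_nhds tendsto_id
    have h1 := ENNReal.tendsto_ofReal (((ht0.mul_const (B ^ 2)).div_const 2).pow 2)
    have h2 := ENNReal.Tendsto.mul_const h1 (Or.inr (measure_ne_top Q₀ univ))
    simpa using h2
  have hsmall : ∀ᶠ t in 𝓝[>] (0 : ℝ), t * B < 1 := by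
    have ht0 : Tendsto (fun t : ℝ => t * B) (𝓝[>] 0) (𝓝 (0 * B)) :=
      (tendsto_nhdsWithin_of_tendsto_nhds tendsto_id).mul_const B
    rw [zero_mul] at ht0
    exact ht0.eventually (gt_mem_nhds one_pos)
  refine tendsto_of_tendsto_of_tendsto_of_le_of_le' tendsto_const_nhds hlim
    (.of_forall fun _ => zero_le) ?_
  filter_upwards [hQ, hsmall, self_mem_nhdsWithin] with t hQt hts (ht : 0 < t)
  set m := Q₀ + Q t with hm
  have h0m : Q₀ ≪ m := Measure.absolutelyContinuous_of_le (Measure.le_add_right le_rfl)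
  have hdens : Measurable fun z => ENNReal.ofReal (1 + t * g z) := by fun_prop
  have hrn : (Q t).rnDeriv m =ᵐ[m] fun z => ENNReal.ofReal (1 + t * g z) * Q₀.rnDeriv m z := by
    rw [hQt]
    exact Measure.rnDeriv_withDensity_left_of_absolutelyContinuous h0m hdens.aemeasurable
  -- The density of `Q₀` factors out of the square, which leaves an integral against `Q₀` of a
  -- function of order `t²`.
  calc _ ≤ ∫⁻ z, Q₀.rnDeriv m z * ENNReal.ofReal
        (((√(ENNReal.ofReal (1 + t * g z)).toReal - 1) / t - 1 / 2 * g z) ^ 2) ∂m := by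
        refine lintegral_mono_ae ?_
        filter_upwards [hrn] with z hz
        rw [hz, ENNReal.toReal_mul, Real.sqrt_mul ENNReal.toReal_nonneg]
        have e : ∀ s b y : ℝ, ((s * b - b) / t - 1 / 2 * y * b) ^ 2
            = b ^ 2 * ((s - 1) / t - 1 / 2 * y) ^ 2 := fun s b y => by ring
        rw [e, ENNReal.ofReal_mul (sq_nonneg _), Real.sq_sqrt ENNReal.toReal_nonneg]
        gcongr
        exact ENNReal.ofReal_toReal_le
    _ = ∫⁻ z, ENNReal.ofReal
        (((√(ENNReal.ofReal (1 + t * g z)).toReal - 1) / t - 1 / 2 * g z) ^ 2) ∂Q₀ :=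
        lintegral_rnDeriv_mul h0m (by fun_prop)
    _ ≤ ∫⁻ _, ENNReal.ofReal ((t * B ^ 2 / 2) ^ 2) ∂Q₀ := by
        refine lintegral_mono_ae ?_
        filter_upwards [hB] with z hz
        have hty : 0 ≤ 1 + t * g z := by nlinarith [neg_abs_le (g z)]
        rw [ENNReal.toReal_ofReal hty]
        refine ENNReal.ofReal_le_ofReal ?_
        rw [← sq_abs]
        gcongr
        exact abs_sqrt_one_add_mul_sub_le ht hz hty
    _ = _ := lintegral_const _

section Model

variable {K d : ℕ} {𝒳 : Type*} [MeasurableSpace 𝒳] {P : Matrix (Fin K) (Fin K) ℝ}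
  {U : Fin K → 𝒳 → EuclideanSpace ℝ (Fin d) → EuclideanSpace ℝ (Fin d)}
  {μ₀ : Measure (Fin K × 𝒳)} {β₀ : EuclideanSpace ℝ (Fin d)} {ν : Measure (Fin K × 𝒳)}

theorem obsLaw_smul_add (P : Matrix (Fin K) (Fin K) ℝ) (a b : ℝ≥0∞)
    (μ ν : Measure (Fin K × 𝒳)) :
    obsLaw P (a • μ + b • ν) = a • obsLaw P μ + b • obsLaw P ν := by
  refine Measure.ext_of_lintegral _ fun f hf => ?_
  simp only [lintegral_add_measure, lintegral_smul_measure, lintegral_obsLaw P _ hf]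

theorem obsLaw_smul (P : Matrix (Fin K) (Fin K) ℝ) (a : ℝ≥0∞) (μ : Measure (Fin K × 𝒳)) :
    obsLaw P (a • μ) = a • obsLaw P μ := by
  refine Measure.ext_of_lintegral _ fun f hf => ?_
  simp only [lintegral_smul_measure, lintegral_obsLaw P _ hf]

/-- The path that mixes `μ₀` with a growing proportion `t ≤ 1` of `ν`. -/
noncomputable def mixturePath (μ₀ ν : Measure (Fin K × 𝒳)) (t : ℝ) : Measure (Fin K × 𝒳) :=
  if t ∈ Icc (0 : ℝ) 1 then ENNReal.ofReal (1 - t) • μ₀ + ENNReal.ofReal t • ν else μ₀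

theorem isProbabilityMeasure_mixturePath [IsProbabilityMeasure μ₀] [IsProbabilityMeasure ν]
    (t : ℝ) : IsProbabilityMeasure (mixturePath μ₀ ν t) := by
  unfold mixturePath
  split_ifs with h
  · constructor
    simp only [Measure.add_apply, Measure.smul_apply, measure_univ, smul_eq_mul, mul_one]
    rw [← ENNReal.ofReal_add (by linarith [h.2]) h.1]
    simp
  · infer_instance

theorem eventually_mem_Icc_nhdsGE : ∀ᶠ t in 𝓝[≥] (0 : ℝ), t ∈ Icc (0 : ℝ) 1 :=
  Icc_mem_nhdsGE one_pos

theorem isRegularPath_mixturePath [IsProbabilityMeasure μ₀] [IsProbabilityMeasure ν]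
    (hφ : MemLp (phi P U β₀) 2 (obsLaw P μ₀)) {c : ℝ≥0} (hν : obsLaw P ν ≤ c • obsLaw P μ₀)
    {M : Fin K × 𝒳 → ℝ} (hM : IsJacobianEnvelope U β₀ M) (hMi : Integrable M μ₀)
    (hMν : ∫⁻ z, ENNReal.ofReal (M z) ∂ν ≠ ∞) :
    IsRegularPath P U μ₀ β₀ (mixturePath μ₀ ν) := by
  refine ⟨isProbabilityMeasure_mixturePath, by simp [mixturePath], ?_, M, hM, hMi, ?_⟩
  · have hfin : ∫⁻ z, ‖phi P U β₀ z‖ₑ ^ 2 ∂(obsLaw P μ₀) < ∞ := by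
      have := hφ.eLpNorm_lt_top
      rw [eLpNorm_lt_top_iff_lintegral_rpow_enorm_lt_top (by simp) (by simp)] at this
      simpa using this
    have hfin' : ∫⁻ z, ‖phi P U β₀ z‖ₑ ^ 2 ∂(obsLaw P ν) < ∞ := by
      refine (lintegral_mono' hν le_rfl).trans_lt ?_
      rw [lintegral_smul_measure]
      exact ENNReal.mul_lt_top ENNReal.coe_lt_top hfin
    refine ⟨(∫⁻ z, ‖phi P U β₀ z‖ₑ ^ 2 ∂(obsLaw P μ₀)
      + ∫⁻ z, ‖phi P U β₀ z‖ₑ ^ 2 ∂(obsLaw P ν)).toNNReal, ?_⟩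
    rw [ENNReal.coe_toNNReal (ENNReal.add_lt_top.2 ⟨hfin, hfin'⟩).ne]
    filter_upwards [eventually_mem_Icc_nhdsGE] with t ht
    rw [mixturePath, if_pos ht, obsLaw_smul_add, lintegral_add_measure, lintegral_smul_measure,
      lintegral_smul_measure]
    refine add_le_add (mul_le_of_le_one_left' ?_) (mul_le_of_le_one_left' ?_)
    · exact ENNReal.ofReal_le_one.2 (by linarith [ht.1])
    · exact ENNReal.ofReal_le_one.2 ht.2
  · have ht0 : Tendsto (fun t : ℝ => t) (𝓝[≥] 0) (𝓝 0) :=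
      tendsto_nhdsWithin_of_tendsto_nhds tendsto_id
    have h1 := ENNReal.Tendsto.mul_const (b := ∫⁻ z, ENNReal.ofReal (M z) ∂μ₀)
      (ENNReal.tendsto_ofReal (ht0.const_sub 1)) (Or.inr hMi.lintegral_lt_top.ne)
    have h2 := ENNReal.Tendsto.mul_const (b := ∫⁻ z, ENNReal.ofReal (M z) ∂ν)
      (ENNReal.tendsto_ofReal ht0) (Or.inr hMν)
    have h3 := h1.add h2
    simp only [sub_zero, ENNReal.ofReal_one, one_mul, ENNReal.ofReal_zero, zero_mul,
      add_zero] at h3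
    refine h3.congr' ?_
    filter_upwards [eventually_mem_Icc_nhdsGE] with t ht
    rw [mixturePath, if_pos ht, lintegral_add_measure, lintegral_smul_measure,
      lintegral_smul_measure]
    rfl

theorem rnDeriv_le_of_le_smul {Z : Type*} [MeasurableSpace Z] {R Q₀ : Measure Z}
    [IsFiniteMeasure R] [IsFiniteMeasure Q₀] {c : ℝ≥0} (h : R ≤ c • Q₀) :
    ∀ᵐ z ∂Q₀, R.rnDeriv Q₀ z ≤ c := by
  refine ae_le_of_forall_setLIntegral_le_of_sigmaFinite (Measure.measurable_rnDeriv _ _)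
    fun s hs _ => ?_
  calc ∫⁻ z in s, R.rnDeriv Q₀ z ∂Q₀ ≤ R s := Measure.setLIntegral_rnDeriv_le s
    _ ≤ (c • Q₀) s := h s
    _ = _ := by simp

/-- The observed mixture has density `1 + t (r - 1)` with respect to `Q₀`, where `r = dR/dQ₀ ≤ c`.
Only the observed laws are compared: `ν` may charge categories that have no mass under `μ₀`. -/
theorem hasScore_mixturePath [IsProbabilityMeasure μ₀] [IsProbabilityMeasure ν]
    (hP : IsTransitionMatrix P) {c : ℝ≥0} (hν : obsLaw P ν ≤ c • obsLaw P μ₀) :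
    ∃ h : MemLp (fun z => ((obsLaw P ν).rnDeriv (obsLaw P μ₀) z).toReal - 1) 2 (obsLaw P μ₀),
      HasScore (obsLaw P μ₀) (fun t => obsLaw P (mixturePath μ₀ ν t)) (h.toLp _) := by
  have := isProbabilityMeasure_obsLaw hP μ₀
  have := isProbabilityMeasure_obsLaw hP ν
  have := fun t => isProbabilityMeasure_mixturePath (μ₀ := μ₀) (ν := ν) t
  have := fun t => isProbabilityMeasure_obsLaw hP (mixturePath μ₀ ν t)
  set Q₀ := obsLaw P μ₀
  set R := obsLaw P ν
  have hac : R ≪ Q₀ := Measure.absolutelyContinuous_of_le_smul hν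
  have hle := rnDeriv_le_of_le_smul hν
  have hb : ∀ᵐ z ∂Q₀, |(R.rnDeriv Q₀ z).toReal - 1| ≤ c + 1 := by
    filter_upwards [hle] with z hz
    have h1 : (R.rnDeriv Q₀ z).toReal ≤ c := ENNReal.toReal_mono ENNReal.coe_ne_top hz
    have h2 : 0 ≤ (R.rnDeriv Q₀ z).toReal := ENNReal.toReal_nonneg
    rw [abs_le]
    constructor <;> linarith [c.2]
  have hmem : MemLp (fun z => (R.rnDeriv Q₀ z).toReal - 1) 2 Q₀ :=
    MemLp.of_bound ((Measure.measurable_rnDeriv _ _).ennreal_toReal.sub_const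
      1).aestronglyMeasurable (c + 1) hb
  refine ⟨hmem, ?_⟩
  have hcoe := hmem.coeFn_toLp
  refine hasScore_of_withDensity (B := c + 1) (Lp.stronglyMeasurable _).measurable ?_ ?_
  · filter_upwards [hb, hcoe] with z h1 h2
    rwa [h2]
  · have hIcc : ∀ᶠ t in 𝓝[>] (0 : ℝ), t ∈ Icc (0 : ℝ) 1 :=
      nhdsWithin_mono _ Ioi_subset_Ici_self eventually_mem_Icc_nhdsGE
    filter_upwards [hIcc] with t ht
    rw [mixturePath, if_pos ht, obsLaw_smul_add]
    have hd : (fun z => ENNReal.ofReal (1 + t * hmem.toLp _ z)) =ᵐ[Q₀]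
        (fun _ => ENNReal.ofReal (1 - t)) + ENNReal.ofReal t • R.rnDeriv Q₀ := by
      filter_upwards [hcoe, hle] with z h1 h2
      have h3 : R.rnDeriv Q₀ z ≠ ∞ := ne_top_of_le_ne_top ENNReal.coe_ne_top h2
      rw [h1, show 1 + t * ((R.rnDeriv Q₀ z).toReal - 1) = (1 - t) + t * (R.rnDeriv Q₀ z).toReal
        by ring, ENNReal.ofReal_add (by linarith [ht.2]) (mul_nonneg ht.1 ENNReal.toReal_nonneg),
        ENNReal.ofReal_mul ht.1, ENNReal.ofReal_toReal h3]
      rfl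
    rw [withDensity_congr_ae hd, withDensity_add_left measurable_const, withDensity_const,
      withDensity_smul _ (Measure.measurable_rnDeriv _ _), Measure.withDensity_rnDeriv_eq _ _ hac]

end Model

/-! ### Functions orthogonal to all scores are constant -/

section Model

variable {K d : ℕ} {𝒳 : Type*} [MeasurableSpace 𝒳] {P : Matrix (Fin K) (Fin K) ℝ}
  {U : Fin K → 𝒳 → EuclideanSpace ℝ (Fin d) → EuclideanSpace ℝ (Fin d)}
  {μ₀ : Measure (Fin K × 𝒳)} {β₀ : EuclideanSpace ℝ (Fin d)}

theorem map_snd_obsLaw (hP : IsTransitionMatrix P) (μ : Measure (Fin K × 𝒳)) :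
    (obsLaw P μ).map Prod.snd = μ.map Prod.snd := by
  refine Measure.ext_of_lintegral _ fun f hf => ?_
  have h1 : ∀ j, ∑ i, ENNReal.ofReal (P i j) = 1 := fun j => by
    rw [← ENNReal.ofReal_sum_of_nonneg fun i _ => hP.1 i j, hP.2 j, ENNReal.ofReal_one]
  have hfs : Measurable fun z : Fin K × 𝒳 => f z.2 := hf.comp measurable_snd
  rw [lintegral_map hf measurable_snd, lintegral_map hf measurable_snd, lintegral_obsLaw P μ hfs]
  simp_rw [← Finset.sum_mul, h1, one_mul]

/-- The product of the counting measure on the categories with the law of `X`. -/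
noncomputable def categoryProd (μ : Measure (Fin K × 𝒳)) : Measure (Fin K × 𝒳) :=
  Measure.sum fun i : Fin K => (μ.map Prod.snd).map (Prod.mk i)

instance (μ : Measure (Fin K × 𝒳)) [IsFiniteMeasure μ] : IsFiniteMeasure (categoryProd μ) := by
  unfold categoryProd; infer_instance

theorem lintegral_categoryProd (μ : Measure (Fin K × 𝒳)) {f : Fin K × 𝒳 → ℝ≥0∞}
    (hf : Measurable f) :
    ∫⁻ z, f z ∂(categoryProd μ) = ∑ i, ∫⁻ x, f (i, x) ∂(μ.map Prod.snd) := by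
  rw [categoryProd, lintegral_sum_measure, tsum_fintype]
  exact Finset.sum_congr rfl fun i _ => lintegral_map hf measurable_prodMk_left

theorem ae_snd_of_ae_categoryProd {μ : Measure (Fin K × 𝒳)} {p : Fin K × 𝒳 → Prop}
    (h : ∀ᵐ z ∂(categoryProd μ), p z) : ∀ᵐ x ∂(μ.map Prod.snd), ∀ i, p (i, x) :=
  ae_all_iff.2 fun i => ae_of_ae_map measurable_prodMk_left.aemeasurable
    (Measure.ae_sum_iff.1 h i)

/-- This is where positivity of `p(y* | x)` enters. It allows mixing laws that charge every hidden
category, whatever the law of `Y` given `X` under `μ₀`. -/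
theorem categoryProd_absolutelyContinuous
    (hpos : ∀ (i : Fin K) (B : Set 𝒳), MeasurableSet B →
      0 < μ₀ (univ ×ˢ B) → 0 < obsLaw P μ₀ ({i} ×ˢ B)) :
    categoryProd μ₀ ≪ obsLaw P μ₀ := by
  refine Measure.AbsolutelyContinuous.mk fun s hs h0 => ?_
  rw [categoryProd, Measure.sum_apply _ hs, tsum_fintype]
  refine Finset.sum_eq_zero fun i _ => ?_
  have hB : MeasurableSet (Prod.mk i ⁻¹' s) := measurable_prodMk_left hs
  rw [Measure.map_apply measurable_prodMk_left hs, Measure.map_apply measurable_snd hB]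
  by_contra hne
  have h1 := hpos i _ hB (by rw [univ_prod]; exact pos_iff_ne_zero.2 hne)
  refine h1.ne' (measure_mono_null ?_ h0)
  rintro ⟨j, x⟩ ⟨hj, hx⟩
  obtain rfl : j = i := hj
  exact hx

/-- Misclassification moves mass between categories over the same `x`, so the density must be
bounded on the whole cylinder over `A`, not just on `S`. The factor `K` counts the hidden categories
that contribute to one observed category, each with weight at most one. -/
theorem obsLaw_restrict_categoryProd_le (hP : IsTransitionMatrix P) [IsFiniteMeasure μ₀]
    [IsFiniteMeasure (obsLaw P μ₀)] (hac : categoryProd μ₀ ≪ obsLaw P μ₀) {A : Set 𝒳}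
    (hA : MeasurableSet A) {n : ℝ≥0}
    (hn : ∀ x ∈ A, ∀ i, (categoryProd μ₀).rnDeriv (obsLaw P μ₀) (i, x) ≤ n)
    {S : Set (Fin K × 𝒳)} (hS : S ⊆ Prod.snd ⁻¹' A) :
    obsLaw P ((categoryProd μ₀).restrict S) ≤ (K * n) • obsLaw P μ₀ := by
  have hP1 : ∀ i j, P i j ≤ 1 := fun i j => by
    rw [← hP.2 j]
    exact Finset.single_le_sum (f := fun i => P i j) (fun i _ => hP.1 i j) (Finset.mem_univ i)
  have hTm : MeasurableSet (Prod.snd ⁻¹' A : Set (Fin K × 𝒳)) := measurable_snd hA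
  refine Measure.le_iff.2 fun s hs => ?_
  set f : Fin K × 𝒳 → ℝ≥0∞ := s.indicator 1 with hf
  have hfm : Measurable f := measurable_one.indicator hs
  set F : Fin K × 𝒳 → ℝ≥0∞ := fun z => (Prod.snd ⁻¹' A).indicator f z with hF
  have hFm : Measurable F := hfm.indicator hTm
  have hFi : ∀ i : Fin K, Measurable fun z : Fin K × 𝒳 => F (i, z.2) := fun i => by fun_prop
  have hFx : ∀ i : Fin K, Measurable fun x : 𝒳 => F (i, x) := fun i => by fun_prop
  rw [← lintegral_indicator_one hs, lintegral_obsLaw P _ hfm]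
  calc ∫⁻ z in S, ∑ i, ENNReal.ofReal (P i z.1) * f (i, z.2) ∂(categoryProd μ₀)
      ≤ ∫⁻ z in Prod.snd ⁻¹' A, ∑ i, ENNReal.ofReal (P i z.1) * f (i, z.2) ∂(categoryProd μ₀) :=
        lintegral_mono_set hS
    _ ≤ ∫⁻ z, ∑ i, F (i, z.2) ∂(categoryProd μ₀) := by
        rw [← lintegral_indicator hTm]
        refine lintegral_mono fun z => ?_
        by_cases hz : z.2 ∈ A
        · rw [indicator_of_mem (by exact hz)]
          refine Finset.sum_le_sum fun i _ => ?_
          have : F (i, z.2) = f (i, z.2) := indicator_of_mem (by exact hz) _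
          rw [this]
          exact mul_le_of_le_one_left' (ENNReal.ofReal_le_one.2 (hP1 _ _))
        · rw [indicator_of_notMem (by exact hz)]
          exact zero_le
    _ = K * ∫⁻ z, F z ∂(categoryProd μ₀) := by
        rw [lintegral_categoryProd _ hFm,
          lintegral_categoryProd _ (Finset.measurable_fun_sum _ fun i _ => hFi i)]
        simp_rw [lintegral_finsetSum _ fun i _ => hFx i]
        simp
    _ = K * ∫⁻ z, (categoryProd μ₀).rnDeriv (obsLaw P μ₀) z * F z ∂(obsLaw P μ₀) := by
        rw [lintegral_rnDeriv_mul hac hFm.aemeasurable]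
    _ ≤ K * ∫⁻ z, n * f z ∂(obsLaw P μ₀) := by
        refine mul_le_mul_right (lintegral_mono fun z => ?_) _
        by_cases hz : z.2 ∈ A
        · have : F z = f z := indicator_of_mem (by exact hz) _
          rw [this]
          gcongr
          exact hn _ hz z.1
        · have : F z = 0 := indicator_of_notMem (by exact hz) _
          rw [this, mul_zero]
          exact zero_le
    _ = ((K * n : ℝ≥0) • obsLaw P μ₀) s := by
        rw [lintegral_const_mul _ hfm, hf, lintegral_indicator_one hs, ← mul_assoc]
        simp [ENNReal.smul_def]

/-- Over almost every `x` the row vector `f(·, x)` satisfies `f P = m 1 = (m 1) P`, as the columns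
of `P` sum to one, and `P` cancels. All `K` equations are needed, hence the counting measure on
categories. -/
theorem ae_eq_const_of_condMean_eq (hP : IsTransitionMatrix P) (hPdet : IsUnit P.det)
    {f : Fin K × 𝒳 → ℝ} {m : ℝ} (h : ∀ᵐ z ∂(categoryProd μ₀), condMean P f z = m) :
    ∀ᵐ z ∂(obsLaw P μ₀), f z = m := by
  have h1 : ∀ᵐ x ∂(μ₀.map Prod.snd), ∀ i, f (i, x) = m := by
    filter_upwards [ae_snd_of_ae_categoryProd h] with x hx
    have h2 : (fun i => f (i, x)) ᵥ* P = (fun _ => m) ᵥ* P := by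
      funext j
      have h3 : ∑ i, P i j * f (i, x) = m := hx j
      simp only [Matrix.vecMul, dotProduct]
      rw [← Finset.mul_sum, hP.2 j, mul_one, ← h3]
      exact Finset.sum_congr rfl fun i _ => mul_comm _ _
    exact fun i => congrFun (Matrix.vecMul_injective_of_isUnit
      ((Matrix.isUnit_iff_isUnit_det P).2 hPdet) h2) i
  rw [← map_snd_obsLaw hP] at h1
  filter_upwards [ae_of_ae_map measurable_snd.aemeasurable h1] with z hz using hz z.1

/-- A mixing law supported where densities and envelope are bounded yields a score, and functions
orthogonal to that score have the same mean under the mixing law as under the true law. -/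
theorem integral_condMean_eq_of_orthogonal (hP : IsTransitionMatrix P) [IsProbabilityMeasure μ₀]
    {ν : Measure (Fin K × 𝒳)} [IsProbabilityMeasure ν] {c : ℝ≥0}
    (hν : obsLaw P ν ≤ c • obsLaw P μ₀) {T : Set (Lp ℝ 2 (obsLaw P μ₀))}
    (hT : ∀ g : Lp ℝ 2 (obsLaw P μ₀),
      HasScore (obsLaw P μ₀) (fun t => obsLaw P (mixturePath μ₀ ν t)) g → g ∈ T)
    {f : Lp ℝ 2 (obsLaw P μ₀)} (hf : f ∈ (Submodule.span ℝ T)ᗮ) :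
    ∫ z, condMean P f z ∂ν = ∫ z, f z ∂(obsLaw P μ₀) := by
  have := isProbabilityMeasure_obsLaw hP μ₀
  have := isProbabilityMeasure_obsLaw hP ν
  obtain ⟨h, hs⟩ := hasScore_mixturePath hP hν
  have hac : obsLaw P ν ≪ obsLaw P μ₀ := Measure.absolutelyContinuous_of_le_smul hν
  have hfm : Measurable f := (Lp.stronglyMeasurable f).measurable
  have hfi : Integrable f (obsLaw P μ₀) := (Lp.memLp f).integrable one_le_two
  have hfν : Integrable f (obsLaw P ν) :=
    (hfi.smul_measure (c := (c : ℝ≥0∞)) ENNReal.coe_ne_top).mono_measure hν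
  rw [(integrable_condMean hP hfm hfν).2, ← integral_rnDeriv_smul hac]
  have h0 := (Submodule.mem_orthogonal _ _).1 hf _ (Submodule.subset_span (hT _ hs))
  rw [L2.inner_def] at h0
  have h1 : ∫ z, (((obsLaw P ν).rnDeriv (obsLaw P μ₀) z).toReal • f z - f z) ∂(obsLaw P μ₀)
      = 0 := by
    rw [← h0]
    refine integral_congr_ae ?_
    filter_upwards [h.coeFn_toLp] with z hz
    rw [hz]
    simp only [RCLike.inner_apply, conj_trivial, smul_eq_mul]
    ring
  rw [integral_sub ((integrable_rnDeriv_smul_iff hac).2 hfν) hfi] at h1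
  linarith

/-- The test laws are normalized restrictions of `categoryProd μ₀` to sets over which densities and
envelope are bounded. Orthogonality makes the average of `condMean P f` over every such set of
positive measure equal to `m`, hence `condMean P f = m` almost everywhere. -/
theorem ae_eq_const_of_mem_orthogonal (hP : IsTransitionMatrix P) (hPdet : IsUnit P.det)
    [IsProbabilityMeasure μ₀]
    (hpos : ∀ (i : Fin K) (B : Set 𝒳), MeasurableSet B →
      0 < μ₀ (univ ×ˢ B) → 0 < obsLaw P μ₀ ({i} ×ˢ B))
    {M : Fin K × 𝒳 → ℝ} (hM : Measurable M) {T : Set (Lp ℝ 2 (obsLaw P μ₀))}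
    (hT : ∀ (ν : Measure (Fin K × 𝒳)) (c : ℝ≥0), IsProbabilityMeasure ν →
      obsLaw P ν ≤ c • obsLaw P μ₀ → ∫⁻ z, ENNReal.ofReal (M z) ∂ν ≠ ∞ →
      ∀ g : Lp ℝ 2 (obsLaw P μ₀),
        HasScore (obsLaw P μ₀) (fun t => obsLaw P (mixturePath μ₀ ν t)) g → g ∈ T)
    {f : Lp ℝ 2 (obsLaw P μ₀)} (hf : f ∈ (Submodule.span ℝ T)ᗮ) :
    ∀ᵐ z ∂(obsLaw P μ₀), f z = ∫ z, f z ∂(obsLaw P μ₀) := by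
  have := isProbabilityMeasure_obsLaw hP μ₀
  have hac := categoryProd_absolutelyContinuous hpos
  set m := ∫ z, f z ∂(obsLaw P μ₀)
  set k := (categoryProd μ₀).rnDeriv (obsLaw P μ₀)
  have hkm : Measurable k := Measure.measurable_rnDeriv _ _
  have hfm : Measurable f := (Lp.stronglyMeasurable f).measurable
  have hfi : Integrable f (obsLaw P μ₀) := (Lp.memLp f).integrable one_le_two
  let A : ℕ → Set 𝒳 := fun n => {x | ∀ i, k (i, x) ≤ n ∧ M (i, x) ≤ n}
  have hA : ∀ n, MeasurableSet (A n) := fun n => by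
    have : A n = ⋂ i, {x | k (i, x) ≤ n} ∩ {x | M (i, x) ≤ n} := by
      ext x; simp [A, mem_iInter]
    rw [this]
    exact MeasurableSet.iInter fun i => (measurableSet_le (by fun_prop) measurable_const).inter
      (measurableSet_le (by fun_prop) measurable_const)
  have hSm : ∀ n, MeasurableSet (Prod.snd ⁻¹' A n : Set (Fin K × 𝒳)) := fun n =>
    measurable_snd (hA n)
  have hle : ∀ n S, S ⊆ Prod.snd ⁻¹' A n →
      obsLaw P ((categoryProd μ₀).restrict S) ≤ (K * n : ℝ≥0) • (obsLaw P μ₀) := fun n S hS =>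
    obsLaw_restrict_categoryProd_le hP hac (hA n) (n := n)
      (fun x hx i => by simpa using (hx i).1) hS
  refine ae_eq_const_of_condMean_eq hP hPdet ?_
  have hn : ∀ n, ∀ᵐ z ∂(categoryProd μ₀), z.2 ∈ A n → condMean P f z = m := fun n => by
    suffices h : (fun z => condMean P f z - m) =ᵐ[(categoryProd μ₀).restrict
        (Prod.snd ⁻¹' A n)] 0 by
      filter_upwards [(ae_restrict_iff' (hSm n)).1 h] with z hz hzA
      exact sub_eq_zero.1 (hz hzA)
    have hint : Integrable (condMean P f) ((categoryProd μ₀).restrict (Prod.snd ⁻¹' A n)) :=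
      (integrable_condMean hP hfm ((hfi.smul_measure (c := ((K * n : ℝ≥0) : ℝ≥0∞))
        ENNReal.coe_ne_top).mono_measure (hle n _ subset_rfl))).1
    refine (hint.sub (integrable_const m)).ae_eq_zero_of_forall_setIntegral_eq_zero
      fun s hs _ => ?_
    rw [Measure.restrict_restrict hs]
    set S := s ∩ Prod.snd ⁻¹' A n
    have hSsub : S ⊆ Prod.snd ⁻¹' A n := inter_subset_right
    have hSmeas : MeasurableSet S := hs.inter (hSm n)
    rcases eq_or_ne (categoryProd μ₀ S) 0 with h0 | h0
    · rw [Measure.restrict_eq_zero.2 h0, integral_zero_measure]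
    have hprob := ProbabilityTheory.cond_isProbabilityMeasure h0
    have hinv : (categoryProd μ₀ S)⁻¹ ≠ ∞ := ENNReal.inv_ne_top.2 h0
    have hν : obsLaw P (ProbabilityTheory.cond (categoryProd μ₀) S)
        ≤ ((categoryProd μ₀ S)⁻¹.toNNReal * (K * n)) • (obsLaw P μ₀) := by
      rw [ProbabilityTheory.cond, obsLaw_smul, mul_smul]
      refine Measure.le_iff.2 fun u _ => ?_
      rw [Measure.smul_apply, Measure.smul_apply, ENNReal.smul_def, ENNReal.coe_toNNReal hinv]
      exact mul_le_mul_right (hle n S hSsub u) _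
    have hMν : ∫⁻ z, ENNReal.ofReal (M z) ∂(ProbabilityTheory.cond (categoryProd μ₀) S) ≠ ∞ := by
      rw [ProbabilityTheory.cond, lintegral_smul_measure]
      refine ENNReal.mul_ne_top hinv (ne_top_of_le_ne_top (b := ∫⁻ _ in S, n ∂(categoryProd μ₀))
        ?_ (setLIntegral_mono' hSmeas fun z hz => ?_))
      · rw [lintegral_const]
        exact ENNReal.mul_ne_top (ENNReal.natCast_ne_top n) (measure_ne_top _ _)
      · exact ENNReal.ofReal_le_natCast.2 ((hSsub hz) z.1).2
    have key := integral_condMean_eq_of_orthogonal hP hν (hT _ _ hprob hν hMν) hf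
    have hintS : Integrable (condMean P f) ((categoryProd μ₀).restrict S) :=
      hint.mono_measure (Measure.restrict_mono hSsub le_rfl)
    rw [ProbabilityTheory.cond, integral_smul_measure] at key
    have hr : ((categoryProd μ₀).real S) ≠ 0 :=
      (ENNReal.toReal_pos h0 (measure_ne_top _ _)).ne'
    have e : ∫ z in S, condMean P f z ∂(categoryProd μ₀) = (categoryProd μ₀).real S * m := by
      rw [show m = _ from key.symm, ENNReal.toReal_inv, smul_eq_mul]
      exact (mul_inv_cancel_left₀ hr _).symm
    simp only [Pi.sub_apply]
    rw [integral_sub hintS (integrable_const m), e, setIntegral_const, smul_eq_mul, sub_self]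
  -- The sets `A n` exhaust almost every fibre: the density is finite `obsLaw P μ₀`-almost
  -- everywhere, and `hac` carries this over to `categoryProd μ₀`.
  have hfin : ∀ᵐ z ∂(categoryProd μ₀), ∃ n, z.2 ∈ A n := by
    have h1 : ∀ᵐ z ∂(categoryProd μ₀), k z < ∞ := hac (Measure.rnDeriv_lt_top _ _)
    have h2 : ∀ᵐ x ∂(μ₀.map Prod.snd), ∃ n, x ∈ A n := by
      filter_upwards [ae_snd_of_ae_categoryProd h1] with x hx
      have h3 : ∀ i, ∃ n : ℕ, k (i, x) ≤ n ∧ M (i, x) ≤ n := fun i => by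
        obtain ⟨n₁, hn₁⟩ := ENNReal.exists_nat_gt (hx i).ne
        obtain ⟨n₂, hn₂⟩ := exists_nat_ge (M (i, x))
        refine ⟨max n₁ n₂, hn₁.le.trans ?_, hn₂.trans ?_⟩
        · exact_mod_cast le_max_left n₁ n₂
        · exact_mod_cast le_max_right n₁ n₂
      choose N hN using h3
      refine ⟨Finset.univ.sup N, fun i => ⟨(hN i).1.trans ?_, (hN i).2.trans ?_⟩⟩
      · exact_mod_cast Finset.le_sup (f := N) (Finset.mem_univ i)
      · exact_mod_cast Finset.le_sup (f := N) (Finset.mem_univ i)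
    refine Measure.ae_sum_iff.2 fun i => (ae_map_iff measurable_prodMk_left.aemeasurable ?_).2 h2
    simp_rw [Set.ofPred_exists]
    exact MeasurableSet.iUnion hSm
  filter_upwards [ae_all_iff.2 hn, hfin] with z h1 ⟨n, h2⟩ using h1 n h2

end Model

/-! ### The efficient influence function -/

theorem influence_apply {K d : ℕ} {𝒳 : Type*} (P : Matrix (Fin K) (Fin K) ℝ)
    (U : Fin K → 𝒳 → EuclideanSpace ℝ (Fin d) → EuclideanSpace ℝ (Fin d))
    (β : EuclideanSpace ℝ (Fin d)) (A : Matrix (Fin d) (Fin d) ℝ) (z : Fin K × 𝒳) (a : Fin d) :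
    (-WithLp.toLp 2 (A *ᵥ (phi P U β z).ofLp) : EuclideanSpace ℝ (Fin d)) a
      = ∑ b, -A a b * phi P U β z b := by
  simp [Matrix.mulVec, dotProduct]

theorem integral_influence_mul {K d : ℕ} {𝒳 : Type*} [MeasurableSpace 𝒳]
    {P : Matrix (Fin K) (Fin K) ℝ}
    {U : Fin K → 𝒳 → EuclideanSpace ℝ (Fin d) → EuclideanSpace ℝ (Fin d)}
    {β : EuclideanSpace ℝ (Fin d)} (A : Matrix (Fin d) (Fin d) ℝ) {Q : Measure (Fin K × 𝒳)}
    {g : Fin K × 𝒳 → ℝ} (h : ∀ b, Integrable (fun z => phi P U β z b * g z) Q) (a : Fin d) :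
    ∫ z, (-WithLp.toLp 2 (A *ᵥ (phi P U β z).ofLp) : EuclideanSpace ℝ (Fin d)) a * g z ∂Q
      = (-Matrix.toEuclideanCLM (𝕜 := ℝ) A
        (WithLp.toLp 2 fun b => ∫ z, phi P U β z b * g z ∂Q)) a := by
  simp_rw [influence_apply, Finset.sum_mul, mul_assoc]
  rw [integral_finsetSum _ fun b _ => (h b).const_mul _]
  simp_rw [integral_const_mul]
  simp [Matrix.mulVec, dotProduct]

theorem theorem1 {K d : ℕ} {𝒳 : Type*} [MeasurableSpace 𝒳]
    (P : Matrix (Fin K) (Fin K) ℝ) (hP : IsTransitionMatrix P) (hPdet : IsUnit P.det)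
    (U : Fin K → 𝒳 → EuclideanSpace ℝ (Fin d) → EuclideanSpace ℝ (Fin d))
    (μ₀ : Measure (Fin K × 𝒳)) [IsProbabilityMeasure μ₀] (β₀ : EuclideanSpace ℝ (Fin d))
    -- `p(y* = i | x) > 0` for all `i` and almost all `x`
    (hpos : ∀ (i : Fin K) (B : Set 𝒳), MeasurableSet B →
      0 < μ₀ (univ ×ˢ B) → 0 < obsLaw P μ₀ ({i} ×ˢ B))
    (hUmeas : ∀ k β, Measurable fun x => U k x β)
    (hUdiff : ∃ N, IsOpen N ∧ β₀ ∈ N ∧ ∀ k x, ContDiffOn ℝ 1 (U k x) N)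
    (hUenv : ∃ M, IsJacobianEnvelope U β₀ M ∧ Integrable M μ₀)
    (hφ : MemLp (phi P U β₀) 2 (obsLaw P μ₀))
    (hβ₀ : SolvesEstimatingEq U μ₀ β₀)
    (hΩ : IsUnit (Omega U μ₀ β₀).det) :
    -- along every regular path the estimating equation defines the parameter, locally uniquely
    (∀ μ, IsRegularPath P U μ₀ β₀ μ →
      (∃ g : Lp ℝ 2 (obsLaw P μ₀), HasScore (obsLaw P μ₀) (fun t => obsLaw P (μ t)) g) →
      (∃ b, IsParameterCurve U β₀ μ b) ∧
      ∀ b b', IsParameterCurve U β₀ μ b → IsParameterCurve U β₀ μ b' → b =ᶠ[𝓝[≥] 0] b') ∧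
    IsEfficientInfluenceFunction (obsLaw P μ₀) (pramSubmodels P U μ₀ β₀)
      (fun z => -WithLp.toLp 2 ((Omega U μ₀ β₀)⁻¹ *ᵥ (phi P U β₀ z).ofLp)) := by
  have := isProbabilityMeasure_obsLaw hP μ₀
  have hpart1 : ∀ μ, IsRegularPath P U μ₀ β₀ μ →
      (∃ g : Lp ℝ 2 (obsLaw P μ₀), HasScore (obsLaw P μ₀) (fun t => obsLaw P (μ t)) g) →
      (∃ b, IsParameterCurve U β₀ μ b) ∧
      ∀ b b', IsParameterCurve U β₀ μ b → IsParameterCurve U β₀ μ b' → b =ᶠ[𝓝[≥] 0] b' :=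
    fun μ hμ ⟨g, hg⟩ => hμ.exists_unique_parameterCurve hP hPdet hUmeas hUdiff hφ hβ₀ hΩ
      (Lp.stronglyMeasurable g).measurable (Lp.memLp g) hg
  have hφa := memLp_phi_apply hφ
  refine ⟨hpart1, fun a => ?_, ?_⟩
  · have hmem : MemLp (fun z => (-WithLp.toLp 2 ((Omega U μ₀ β₀)⁻¹ *ᵥ (phi P U β₀ z).ofLp) :
        EuclideanSpace ℝ (Fin d)) a) 2 (obsLaw P μ₀) := by
      simp_rw [influence_apply]
      exact memLp_finsetSum _ fun b _ => (hφa b).const_mul _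
    have hmean : ∫ z, (-WithLp.toLp 2 ((Omega U μ₀ β₀)⁻¹ *ᵥ (phi P U β₀ z).ofLp) :
        EuclideanSpace ℝ (Fin d)) a ∂(obsLaw P μ₀) = 0 := by
      have hzero : ∀ b, ∫ z, phi P U β₀ z b ∂(obsLaw P μ₀) = 0 := fun b => by
        rw [← (integral_estimating_eq hP hPdet hUmeas
          (fun a => (hφa a).integrable one_le_two)).2 b, hβ₀.2]
        rfl
      simp_rw [influence_apply]
      rw [integral_finsetSum _ fun b _ => ((hφa b).integrable one_le_two).const_mul _]
      simp_rw [integral_const_mul, hzero]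
      simp
    refine ⟨hmem, ?_⟩
    -- The closed span is the double orthogonal complement, so a mean-zero function belongs to it
    -- once the orthogonal complement of the scores contains only constants.
    rw [← Submodule.orthogonal_orthogonal_eq_closure, Submodule.mem_orthogonal]
    intro f hf
    obtain ⟨M, hM, hMi⟩ := hUenv
    have hconst := ae_eq_const_of_mem_orthogonal hP hPdet hpos hM.1
      (fun ν c hν hle hMν g hg => by
        have hreg := isRegularPath_mixturePath hφ hle hM hMi hMν
        -- A submodel includes its parameter curve, so the first claim is needed before the score of
        -- a mixture counts as a tangent.
        obtain ⟨b, hb⟩ := (hpart1 _ hreg ⟨g, hg⟩).1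
        exact ⟨(fun t => obsLaw P (mixturePath μ₀ ν t), b),
          ⟨_, hreg, fun t => rfl, hb⟩, hg⟩) hf
    rw [L2.inner_def]
    calc _ = ∫ z, (∫ z, f z ∂(obsLaw P μ₀)) * (-WithLp.toLp 2 ((Omega U μ₀ β₀)⁻¹ *ᵥ
          (phi P U β₀ z).ofLp) : EuclideanSpace ℝ (Fin d)) a ∂(obsLaw P μ₀) := by
          refine integral_congr_ae ?_
          filter_upwards [hconst, hmem.coeFn_toLp] with z h1 h2
          rw [h1, h2]
          simp only [RCLike.inner_apply, conj_trivial]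
          ring
      _ = 0 := by rw [integral_const_mul, hmean, mul_zero]
  · rintro s ⟨μ, hμ, hsμ, hb⟩ g hg
    have hs1 : s.1 = fun t => obsLaw P (μ t) := funext hsμ
    rw [hs1] at hg
    have hd := hμ.hasDerivWithinAt_parameterCurve hP hPdet hUmeas hUdiff hφ hβ₀ hΩ
      (Lp.stronglyMeasurable g).measurable (Lp.memLp g) hg hb
    convert hd using 1
    ext a
    exact integral_influence_mul _ (fun b => (hφa b).integrable_mul (Lp.memLp g)) a
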